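/- Let $\Gamma$ be a finite group, $\Gamma_*$ its set of conjugacy classes and $c^0\in\Gamma_*$ the class of the identity. For $n\ge 0$ let $\Gamma_n=\Gamma^n\rtimes S_n$ be the wreath product, with $(g,\sigma)(h,\tau)=(g\,\sigma(h),\sigma\tau)$, $\sigma(h)_i=h_{\sigma^{-1}(i)}$, and let $\Gamma_\infty=\bigcup_n\Gamma_n$ be the union under the natural embeddings $\Gamma_n\subset\Gamma_{n+1}$. For a cycle $(i_1\,i_2\cdots i_k)$ of $\sigma$ (fixed points being $1$-cycles) the cycle-product of $x=(g,\sigma)$ is $g_{i_k}\cdots g_{i_1}$, well defined up to conjugacy in $\Gamma$. Let $\mathcal P(\Gamma_*)$ be the set of families $\rho=(\rho(c))_{c\in\Gamma_*}$ of partitions, let $\|\rho\|$ be the sum of all parts of all $\rho(c)$, and let $\ell(\rho(c))$ be the number of parts of $\rho(c)$. The modified type of $x\in\Gamma_\infty$ is the $\lambda\in\mathcal P(\Gamma_*)$ such that, for $c\ne c^0$, the parts of $\lambda(c)$ are the lengths of the cycles of $x$ with cycle-product in $c$, and the parts of $\lambda(c^0)$ are the nonzero numbers $k-1$, where $k$ runs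 over the lengths of the cycles with cycle-product $1$. Let $\mathcal K_\lambda\subset\Gamma_\infty$ be the conjugacy class of all elements of modified type $\lambda$, and let $K_\lambda(n)\in\mathbb Z[\Gamma_n]$ be the sum of the elements of $\mathcal K_\lambda\cap\Gamma_n$; the nonzero $K_\nu(n)$, namely those with $n\ge\|\nu\|+\ell(\nu(c^0))$, form a $\mathbb Z$-basis of the class algebra $R_{\mathbb Z}(\Gamma_n)$, the center of $\mathbb Z[\Gamma_n]$. Write $$K_\lambda(n)K_\mu(n)=\sum_\nu a_{\lambda\mu}^\nu(n)\,K_\nu(n),\qquad a_{\lambda\mu}^\nu(n)\in\mathbb Z;$$ the integer $a_{\lambda\mu}^\nu(n)$ is determined when $n\ge\|\nu\|+\ell(\nu(c^0))$ and arbitrary otherwise. For $Y\subset\Gamma_\infty$ let $\mathbb N(Y)$ be the set of indices $j$ such that $\sigma(j)\ne j$ or $g_j\ne 1$ for some $(g,\sigma)\in Y$. For a class $\mathcal C$ of tuples of elements of $\Gamma_\infty$ under simultaneous conjugation let $|\mathbb N(\mathcal C)|$ be the common cardinality of $\mathbb N(x_1,\dots,x_r)$ for $(x_1,\dots,x_r)\in\mathcal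 C$. Theorem. Let $\lambda,\mu,\nu\in\mathcal P(\Gamma_*)$. 1. There is a unique polynomial $f_{\lambda\mu}^\nu\in\mathbb Q[t]$ such that $f_{\lambda\mu}^\nu(n)=a_{\lambda\mu}^\nu(n)$ for all $n\ge\|\nu\|+\ell(\nu(c^0))$. For fixed $\lambda,\mu$ only finitely many $f_{\lambda\mu}^\nu$ are nonzero, all values $f_{\lambda\mu}^\nu(n)$, $n\ge 0$, are integers, and $K_\lambda(n)K_\mu(n)=\sum_\nu f_{\lambda\mu}^\nu(n)K_\nu(n)$ for every $n\ge 0$; so, with the undetermined $a_{\lambda\mu}^\nu(n)$ suitably chosen, $f_{\lambda\mu}^\nu(n)=a_{\lambda\mu}^\nu(n)$ for all $n$. 2. If there is a pair $(x,y)$ with $x\in\mathcal K_\lambda$, $y\in\mathcal K_\mu$, $xy\in\mathcal K_\nu$, then $f_{\lambda\mu}^\nu\neq0$ and its degree is the greatest value of $|\mathbb N(\mathcal C)|-|\mathbb N(\mathcal K_\nu)|$ over all classes $\mathcal C$ of such pairs. If there is no such pair, then $f_{\lambda\mu}^\nu=0$. 3. If $\|\nu\|=\|\lambda\|+\|\mu\|$,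 then $f_{\lambda\mu}^\nu$ is a constant, equal to a non-negative integer, and $\mathbb N(x,y)=\mathbb N(xy)$ for all $x\in\mathcal K_\lambda$, $y\in\mathcal K_\mu$ with $xy\in\mathcal K_\nu$. -/

import Mathlib

open Polynomial

noncomputable section

namespace WreathFH

/-- The wreath product `Γ ≀ Sym(α)`: pairs `(g, σ)` with `g : α → Γ`, `σ` a permutation of `α`, and
`(g, σ)(h, τ) = (g σ(h), σ τ)`, where `σ(h) i = h (σ⁻¹ i)`. -/
abbrev Wreath (Γ : Type*) [Group Γ] (α : Type*) : Type _ :=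
  (α → Γ) ⋊[(mulAutArrow : Equiv.Perm α →* MulAut (α → Γ))] Equiv.Perm α

theorem mul_left_apply {Γ : Type*} [Group Γ] {α : Type*} (x y : Wreath Γ α) (j : α) :
    (x * y).left j = x.left j * y.left (x.right⁻¹ j) := rfl

theorem inv_left_apply {Γ : Type*} [Group Γ] {α : Type*} (x : Wreath Γ α) (j : α) :
    (x⁻¹).left j = (x.left (x.right j))⁻¹ := by
  simp [SemidirectProduct.inv_left, mulAutArrow]
  rfl

/-- The points moved by `σ` or carrying a nontrivial entry of `g`, for `x = (g, σ)`. -/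
def supp {Γ : Type*} [Group Γ] {α : Type*} (x : Wreath Γ α) : Set α :=
  {j | x.right j ≠ j ∨ x.left j ≠ 1}

theorem notMem_supp {Γ : Type*} [Group Γ] {α : Type*} {x : Wreath Γ α} {j : α} :
    j ∉ supp x ↔ x.right j = j ∧ x.left j = 1 := by
  simp [supp]

theorem supp_one {Γ : Type*} [Group Γ] {α : Type*} : supp (1 : Wreath Γ α) = ∅ := by
  ext j; simp [supp]

theorem supp_mul_subset {Γ : Type*} [Group Γ] {α : Type*} (x y : Wreath Γ α) :
    supp (x * y) ⊆ supp x ∪ supp y := by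
  intro j
  contrapose
  simp only [Set.mem_union, not_or, notMem_supp]
  rintro ⟨⟨h1, h2⟩, h3, h4⟩
  have h5 : x.right⁻¹ j = j := by rw [Equiv.Perm.inv_eq_iff_eq, h1]
  refine ⟨?_, ?_⟩
  · rw [SemidirectProduct.mul_right, Equiv.Perm.mul_apply, h3, h1]
  · rw [mul_left_apply, h5, h2, h4, one_mul]

theorem supp_inv_subset {Γ : Type*} [Group Γ] {α : Type*} (x : Wreath Γ α) :
    supp (x⁻¹) ⊆ supp x := by
  intro j
  contrapose
  simp only [notMem_supp]
  rintro ⟨h1, h2⟩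
  refine ⟨?_, ?_⟩
  · rw [SemidirectProduct.inv_right, Equiv.Perm.inv_eq_iff_eq, h1]
  · rw [inv_left_apply, h1, h2, inv_one]

/-- The wreath product `Γ_n = Γ^n ⋊ S_n`. -/
abbrev WreathFin (Γ : Type*) [Group Γ] (n : ℕ) : Type _ := Wreath Γ (Fin n)

/-- `Γ_∞`, the union of all `Γ_n`: the pairs `(g, σ)` over the countable index set `ℕ`
with finite support. -/
def wreathInf (Γ : Type*) [Group Γ] : Subgroup (Wreath Γ ℕ) where
  carrier := {x | (supp x).Finite}
  mul_mem' {x y} hx hy := (Set.Finite.union hx hy).subset (supp_mul_subset x y)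
  one_mem' := by simp [supp_one]
  inv_mem' {x} hx := Set.Finite.subset hx (supp_inv_subset x)

/-- The embedding of `Γ_n` in the wreath product over `ℕ`: extend `g` by `1` and `σ` by the
identity outside `{0, …, n - 1}`. -/
def extend (Γ : Type*) [Group Γ] (n : ℕ) : WreathFin Γ n →* Wreath Γ ℕ where
  toFun x :=
    ⟨fun j => if h : j < n then x.left ⟨j, h⟩ else 1,
      Equiv.Perm.extendDomainHom (Fin.equivSubtype (n := n)) x.right⟩
  map_one' := by
    ext j
    · simp
    · simp
  map_mul' x y := by
    apply SemidirectProduct.ext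
    · funext j
      rw [mul_left_apply]
      simp only [← map_inv]
      by_cases h : j < n
      · have e : Equiv.Perm.extendDomainHom (Fin.equivSubtype (n := n)) x.right⁻¹ j
            = ((x.right⁻¹ ⟨j, h⟩ : Fin n) : ℕ) := by
          exact Equiv.Perm.extendDomain_apply_image x.right⁻¹ Fin.equivSubtype ⟨j, h⟩
        simp only [e, h, dif_pos, Fin.is_lt, Fin.eta]
        rw [mul_left_apply]
      · have e : Equiv.Perm.extendDomainHom (Fin.equivSubtype (n := n)) x.right⁻¹ j = j :=
          Equiv.Perm.extendDomain_apply_not_subtype x.right⁻¹ Fin.equivSubtype h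
        simp only [e, h, dif_neg, not_false_iff, mul_one]
    · simp

theorem extend_mem (Γ : Type*) [Group Γ] (n : ℕ) (x : WreathFin Γ n) :
    extend Γ n x ∈ wreathInf Γ := by
  refine (Set.finite_lt_nat n).subset ?_
  intro j
  contrapose
  intro h
  have h' : ¬ j < n := h
  rw [notMem_supp]
  exact ⟨Equiv.Perm.extendDomain_apply_not_subtype x.right Fin.equivSubtype h',
    dif_neg h'⟩

/-- The natural embedding `Γ_n → Γ_∞`. -/
def toInf (Γ : Type*) [Group Γ] (n : ℕ) : WreathFin Γ n →* wreathInf Γ :=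
  (extend Γ n).codRestrict (wreathInf Γ) (extend_mem Γ n)

/-- A family of partitions indexed by the conjugacy classes of `Γ`; a partition is a finite
multiset of positive integers (its parts). -/
abbrev ModType (Γ : Type*) [Group Γ] : Type _ := ConjClasses Γ → Multiset ℕ+

/-- The degree `‖ρ‖`, the sum of all parts of all the partitions. -/
def degree {Γ : Type*} [Group Γ] (ρ : ModType Γ) : ℕ :=
  ∑ᶠ c : ConjClasses Γ, ((ρ c).map (fun k : ℕ+ => (k : ℕ))).sum

/-- The cycle-product `g_{i_k} ⋯ g_{i_2} g_{i_1}` of `x = (g, σ)` at the cycle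
`(i_1 i_2 ⋯ i_k)` of `σ`, where `i_1 = i` and `i_{s+1} = σ i_s`. -/
def cycleProduct {Γ : Type*} [Group Γ] {α : Type*} (x : Wreath Γ α) (i : α) : Γ :=
  ((List.range (Function.minimalPeriod x.right i)).map
    (fun s => x.left ((x.right ^ s) i))).reverse.prod

/-- The number of cycles of `x = (g, σ)` of length `r` (fixed points of `σ` being cycles of
length `1`) whose cycle-product lies in the conjugacy class `c`; that is, `m_r(ρ(c))` for the
type `ρ` of `x`. A cycle is identified with its underlying set. -/
def numCycles {Γ : Type*} [Group Γ] {α : Type*} (x : Wreath Γ α) (r : ℕ)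
    (c : ConjClasses Γ) : ℕ :=
  Set.ncard {s : Set α | ∃ i : α, s = {j | x.right.SameCycle i j} ∧ s.ncard = r ∧
    ConjClasses.mk (cycleProduct x i) = c}

/-- `lam` is the modified type of `x`: for `c ≠ 1`, `lam c` records the lengths of the cycles with
cycle-product in `c`; `lam 1` records the lengths, lowered by one, of the cycles with
trivial cycle-product (the resulting zeros being dropped). -/
def HasModType {Γ : Type*} [Group Γ] {α : Type*} (x : Wreath Γ α) (lam : ModType Γ) : Prop :=
  (∀ r : ℕ+, (lam 1).count r = numCycles x (r + 1) 1) ∧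
    ∀ c : ConjClasses Γ, c ≠ 1 → ∀ r : ℕ+, (lam c).count r = numCycles x r c

/-- The class `𝒦_lam` in `Γ_∞` of the elements of modified type `lam`. -/
def classInf {Γ : Type*} [Group Γ] (lam : ModType Γ) : Set (wreathInf Γ) :=
  {x | HasModType (x : Wreath Γ ℕ) lam}

/-- `K_lam(n)`, the sum of the elements of `Γ_n ∩ 𝒦_lam`, in the group algebra `ℤ[Γ_n]`
(whose center is the class algebra). -/
def classSum {Γ : Type*} [Group Γ] (n : ℕ) (lam : ModType Γ) :
    MonoidAlgebra ℤ (WreathFin Γ n) :=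
  ∑ᶠ x ∈ {x : WreathFin Γ n | toInf Γ n x ∈ classInf lam}, MonoidAlgebra.single x 1

/-- `a` is a system of structure constants for `K_lam(n) K_mu(n)`:
`K_lam(n) K_mu(n) = ∑_ν a ν K_ν(n)`. -/
def IsStructureConstants {Γ : Type*} [Group Γ] (n : ℕ) (lam mu : ModType Γ)
    (a : ModType Γ →₀ ℤ) : Prop :=
  classSum n lam * classSum n mu = a.sum fun ν m => m • classSum n ν

/-- `ℕ(Y)`, the union of the supports of the elements of `Y`. -/
def suppSet {Γ : Type*} [Group Γ] (Y : Set (wreathInf Γ)) : Set ℕ :=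
  {j | ∃ x ∈ Y, j ∈ supp (x : Wreath Γ ℕ)}

/-- Simultaneous conjugacy of `r`-tuples of elements of `Γ_∞`. -/
def tupleSetoid (Γ : Type*) [Group Γ] (r : ℕ) : Setoid (Fin r → wreathInf Γ) where
  r x y := ∃ z : wreathInf Γ, ∀ i, y i = z * x i * z⁻¹
  iseqv :=
    { refl := fun x => ⟨1, fun i => by simp⟩
      symm := by
        rintro x y ⟨z, hz⟩
        exact ⟨z⁻¹, fun i => by rw [hz i]; group⟩
      trans := by
        rintro x y w ⟨z, hz⟩ ⟨t, ht⟩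
        exact ⟨t * z, fun i => by rw [ht i, hz i]; group⟩ }

/-- The conjugacy classes of `r`-tuples of elements of `Γ_∞`. -/
abbrev TupleClass (Γ : Type*) [Group Γ] (r : ℕ) : Type _ := Quotient (tupleSetoid Γ r)

theorem mem_supp_conj {Γ : Type*} [Group Γ] {α : Type*} (z x : Wreath Γ α) (j : α) :
    z.right j ∈ supp (z * x * z⁻¹) ↔ j ∈ supp x := by
  rw [← not_iff_not, notMem_supp, notMem_supp]
  have hr : (z * x * z⁻¹).right (z.right j) = z.right (x.right j) := by simp
  rw [hr, (z.right).injective.eq_iff]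
  refine and_congr_right fun h => ?_
  have hl : (z * x * z⁻¹).left (z.right j)
      = z.left (z.right j) * x.left j * (z.left (z.right j))⁻¹ := by
    rw [mul_left_apply, mul_left_apply, inv_left_apply]
    have e : (z * x).right⁻¹ (z.right j) = j := by
      rw [Equiv.Perm.inv_eq_iff_eq, SemidirectProduct.mul_right, Equiv.Perm.mul_apply, h]
    have e' : z.right⁻¹ (z.right j) = j := by simp
    rw [e, e']
  rw [hl, conj_eq_one_iff]

theorem suppSet_conj {Γ : Type*} [Group Γ] {r : ℕ} (x y : Fin r → wreathInf Γ)
    (h : (tupleSetoid Γ r).r x y) :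
    (suppSet (Set.range x)).ncard = (suppSet (Set.range y)).ncard := by
  obtain ⟨z, hz⟩ := h
  rw [← Set.ncard_image_of_injective _ (z : Wreath Γ ℕ).right.injective]
  congr 1
  ext j
  obtain ⟨j, rfl⟩ := (z : Wreath Γ ℕ).right.surjective j
  rw [(z : Wreath Γ ℕ).right.injective.mem_set_image]
  simp only [suppSet, Set.mem_ofPred_eq, Set.exists_range_iff]
  refine exists_congr fun i => ?_
  rw [hz i]
  exact (mem_supp_conj _ _ _).symm

/-- `|ℕ(𝒞)|`, the common value of `|ℕ(x_1, …, x_r)|` for `(x_1, …, x_r) ∈ 𝒞`. -/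
def TupleClass.suppCard {Γ : Type*} [Group Γ] {r : ℕ} (C : TupleClass Γ r) : ℕ :=
  Quotient.lift (fun x : Fin r → wreathInf Γ => (suppSet (Set.range x)).ncard) suppSet_conj C

/-- The classes of pairs `(x, y)` with `x ∈ 𝒦_lam`, `y ∈ 𝒦_mu` and `x y ∈ 𝒦_nu`. -/
def pairClasses {Γ : Type*} [Group Γ] (lam mu nu : ModType Γ) : Set (TupleClass Γ 2) :=
  {C | ∃ x ∈ classInf lam, ∃ y ∈ classInf mu, x * y ∈ classInf nu ∧
    C = Quotient.mk (tupleSetoid Γ 2) ![x, y]}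

end WreathFH

end

noncomputable section

namespace WreathFH

/-! The coefficient of `z` in `K_λ(n) K_μ(n)` is the number of factorizations `z = x y` with `x` of
type `λ` and `y` of type `μ`. Sort them by the total support `S = supp x ∪ supp y`, which contains
`supp z`. The number with a given `S` depends only on `|S|` and on the type `ν` of `z`, since
elements of one type over one finite index set are conjugate (`HasModType.isConj`); this is
`pairNumber`. With `m = ‖ν‖ + ℓ(ν(1)) = |supp z|` there are `choose (n - m) d` sets `S` of size `m +
d`, so the coefficient is `∑ d, choose (n - m) d * pairNumber (m + d)` (`ncard_factorizations`).
This sum is finite with bounds independent of `n`, hence polynomial in `n`; its values are integers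
for every `n` because `choose` is integer-valued on all integers. The `d`-th term has degree exactly
`d`, so the degree is the largest `d` with `pairNumber (m + d) ≠ 0`, that is, with a class of pairs
whose support has `m + d` points.

For additive degrees, let `q = |Γ| + 1` and let `Γ_n` act on functions `φ` with values in `Γ ∪ {0}`.
A function fixed by `x` is determined on each cycle by one value, which is free if the cycle-product
is trivial and is `0` otherwise. So the fixed functions of an element of type `ρ` number `q ^ (n -
‖ρ‖)` and are cut out by `‖ρ‖` equations `a φ(i) = b φ(j)`. Each such equation costs at most one
variable, so `x` and `y` have at least `q ^ (n - ‖λ‖ - ‖μ‖)` common fixed functions, all of them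
fixed by `x y`. If `‖ν‖ = ‖λ‖ + ‖μ‖` the two sets coincide. A point outside `supp (x y)` then gives
a delta function fixed by `x` and by `y`, so it lies outside both supports, and only `d = 0`
contributes. -/

variable {Γ : Type*} [Group Γ] {α β γ ι κ : Type*}

/-! ### Cycle-products and relabelling of the index set -/

/-- The product `g_{i_s} ⋯ g_{i_2} g_{i_1}` along the first `s` steps of the `σ`-orbit of `i = i_1`,
for `x = (g, σ)`. -/
def partialProduct (x : Wreath Γ α) (s : ℕ) (i : α) : Γ :=
  ((List.range s).map (fun t => x.left ((x.right ^ t) i))).reverse.prod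

theorem cycleProduct_eq (x : Wreath Γ α) (i : α) :
    cycleProduct x i = partialProduct x (Function.minimalPeriod x.right i) i := rfl

@[simp]
theorem partialProduct_zero (x : Wreath Γ α) (i : α) : partialProduct x 0 i = 1 := by
  simp [partialProduct]

theorem partialProduct_succ (x : Wreath Γ α) (s : ℕ) (i : α) :
    partialProduct x (s + 1) i = x.left ((x.right ^ s) i) * partialProduct x s i := by
  simp [partialProduct, List.range_succ]

/-- `y` is obtained from `x` by relabelling the points along `e`, rescaling by `h`, and adding
trivial points. -/
structure Intertwines (e : α ↪ β) (h : α → Γ) (x : Wreath Γ α) (y : Wreath Γ β) : Prop where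
  right (i : α) : y.right (e i) = e (x.right i)
  left (i : α) : y.left (e i) * h i = h (x.right i) * x.left i
  notMem_supp (j : β) : j ∉ Set.range e → j ∉ supp y

namespace Intertwines

variable {e : α ↪ β} {h : α → Γ} {x : Wreath Γ α} {y : Wreath Γ β}

theorem pow (H : Intertwines e h x y) (n : ℕ) (i : α) :
    (y.right ^ n) (e i) = e ((x.right ^ n) i) := by
  induction n with
  | zero => simp
  | succ n ih => rw [pow_succ', pow_succ', Equiv.Perm.mul_apply, ih, H.right, Equiv.Perm.mul_apply]

theorem zpow (H : Intertwines e h x y) (n : ℤ) (i : α) :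
    (y.right ^ n) (e i) = e ((x.right ^ n) i) := by
  cases n with
  | ofNat n => exact_mod_cast H.pow n i
  | negSucc n =>
    rw [zpow_negSucc, zpow_negSucc, Equiv.Perm.inv_eq_iff_eq, H.pow, ← Equiv.Perm.mul_apply,
      mul_inv_cancel, Equiv.Perm.one_apply]

theorem sameCycle_iff (H : Intertwines e h x y) {i j : α} :
    y.right.SameCycle (e i) (e j) ↔ x.right.SameCycle i j := by
  simp [Equiv.Perm.SameCycle, H.zpow]

theorem image_cycle (H : Intertwines e h x y) (i : α) :
    e '' {j | x.right.SameCycle i j} = {j | y.right.SameCycle (e i) j} := by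
  ext j
  constructor
  · rintro ⟨j, hj, rfl⟩
    exact H.sameCycle_iff.2 hj
  · rintro ⟨n, rfl⟩
    exact ⟨(x.right ^ n) i, ⟨n, rfl⟩, (H.zpow n i).symm⟩

theorem minimalPeriod_eq (H : Intertwines e h x y) (i : α) :
    Function.minimalPeriod y.right (e i) = Function.minimalPeriod x.right i := by
  rw [Function.minimalPeriod_eq_minimalPeriod_iff]
  intro n
  simp only [Function.IsPeriodicPt, Function.IsFixedPt, ← Equiv.Perm.coe_pow, H.pow,
    e.injective.eq_iff]

theorem partialProduct_eq (H : Intertwines e h x y) (s : ℕ) (i : α) :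
    partialProduct y s (e i) * h i = h ((x.right ^ s) i) * partialProduct x s i := by
  induction s with
  | zero => simp
  | succ s ih =>
    rw [partialProduct_succ, partialProduct_succ, mul_assoc, ih, H.pow, ← mul_assoc, H.left,
      pow_succ', Equiv.Perm.mul_apply, mul_assoc]

/-- After a full period the path returns to `i`, so the relation between partial products becomes a
conjugation by `h i`. -/
theorem mk_cycleProduct (H : Intertwines e h x y) (i : α) :
    ConjClasses.mk (cycleProduct y (e i)) = ConjClasses.mk (cycleProduct x i) := by
  have h1 := H.partialProduct_eq (Function.minimalPeriod x.right i) i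
  have h2 : (x.right ^ Function.minimalPeriod x.right i) i = i := by
    rw [Equiv.Perm.coe_pow]; exact Function.iterate_minimalPeriod
  rw [h2] at h1
  rw [ConjClasses.mk_eq_mk_iff_isConj, cycleProduct_eq, cycleProduct_eq, H.minimalPeriod_eq]
  refine (isConj_iff.2 ⟨h i, ?_⟩ : IsConj _ _).symm
  rw [← h1]; group

/-- The points outside the range of `e` are 1-cycles with trivial cycle-product. They are the only
cycles of `y` that do not come from `x`, and `hrc` excludes exactly these. -/
theorem numCycles_eq (H : Intertwines e h x y) (r : ℕ) (c : ConjClasses Γ) (hrc : r = 1 → c ≠ 1) :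
    numCycles y r c = numCycles x r c := by
  unfold numCycles
  rw [← Set.ncard_image_of_injective _ (Set.image_injective.2 e.injective)]
  congr 1
  ext s
  constructor
  · rintro ⟨j, rfl, hr, hc⟩
    by_cases hj : j ∈ Set.range e
    · obtain ⟨i, rfl⟩ := hj
      refine ⟨_, ⟨i, rfl, ?_, ?_⟩, H.image_cycle i⟩
      · rw [← hr, ← H.image_cycle, Set.ncard_image_of_injective _ e.injective]
      · rw [← hc, H.mk_cycleProduct]
    · obtain ⟨h1, h2⟩ := WreathFH.notMem_supp.1 (H.notMem_supp j hj)
      exfalso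
      have h3 : {k | y.right.SameCycle j k} = {j} := by
        ext k
        constructor
        · rintro ⟨n, rfl⟩
          exact Equiv.Perm.zpow_apply_eq_self_of_apply_eq_self h1 n
        · rintro rfl
          exact Equiv.Perm.SameCycle.refl _ _
      rw [h3, Set.ncard_singleton] at hr
      refine hrc hr.symm ?_
      have h4 : Function.minimalPeriod y.right j = 1 :=
        Function.minimalPeriod_eq_one_iff_isFixedPt.2 h1
      rw [← hc, cycleProduct_eq, h4, partialProduct_succ]
      simp [h2]
      rfl
  · rintro ⟨s, ⟨i, rfl, hr, hc⟩, rfl⟩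
    refine ⟨e i, H.image_cycle i, ?_, ?_⟩
    · rw [← hr, Set.ncard_image_of_injective _ e.injective]
    · rw [← hc, H.mk_cycleProduct]

theorem hasModType_iff (H : Intertwines e h x y) (lam : ModType Γ) :
    HasModType y lam ↔ HasModType x lam := by
  unfold HasModType
  refine and_congr (forall_congr' fun r => ?_)
    (forall_congr' fun c => forall_congr' fun hc => forall_congr' fun r => ?_)
  · rw [H.numCycles_eq]
    intro h
    exact absurd h (by simp)
  · rw [H.numCycles_eq]
    exact fun _ => hc

theorem mem_supp_iff (H : Intertwines e h x y) {i : α} : e i ∈ supp y ↔ i ∈ supp x := by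
  rw [← not_iff_not, WreathFH.notMem_supp, WreathFH.notMem_supp, H.right, e.injective.eq_iff]
  refine and_congr_right fun hi => ?_
  have h1 := H.left i
  rw [hi] at h1
  constructor
  · intro h2
    rw [h2, one_mul] at h1
    exact mul_eq_left.1 h1.symm
  · intro h2
    rw [h2, mul_one] at h1
    exact mul_eq_right.1 h1

theorem image_supp (H : Intertwines e h x y) : e '' supp x = supp y := by
  ext j
  constructor
  · rintro ⟨i, hi, rfl⟩
    exact H.mem_supp_iff.2 hi
  · intro hj
    by_cases h : j ∈ Set.range e
    · obtain ⟨i, rfl⟩ := h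
      exact ⟨i, H.mem_supp_iff.1 hj, rfl⟩
    · exact absurd hj (H.notMem_supp j h)

theorem symm {e : α ≃ β} (H : Intertwines e.toEmbedding h x y) :
    Intertwines e.symm.toEmbedding (fun j => (h (e.symm j))⁻¹) y x where
  right j := by
    obtain ⟨i, rfl⟩ := e.surjective j
    have := H.right i
    simp only [Equiv.coe_toEmbedding] at this ⊢
    rw [this, e.symm_apply_apply, e.symm_apply_apply]
  left j := by
    obtain ⟨i, rfl⟩ := e.surjective j
    have h1 := H.right i
    have h2 := H.left i
    simp only [Equiv.coe_toEmbedding] at h1 h2 ⊢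
    rw [h1, e.symm_apply_apply, e.symm_apply_apply, mul_inv_eq_iff_eq_mul, mul_assoc, h2,
      inv_mul_cancel_left]
  notMem_supp j hj := by simp at hj

theorem trans {e' : β ↪ γ} {h' : β → Γ} {z : Wreath Γ γ} (H : Intertwines e h x y)
    (H' : Intertwines e' h' y z) : Intertwines (e.trans e') (fun i => h' (e i) * h i) x z where
  right i := by simp [H'.right, H.right]
  left i := by
    simp only [Function.Embedding.trans_apply]
    rw [← mul_assoc, H'.left, H.right, mul_assoc, H.left, mul_assoc]
  notMem_supp k hk := by
    rw [← H'.image_supp]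
    rintro ⟨j, hj, rfl⟩
    refine H.notMem_supp j ?_ hj
    rintro ⟨i, rfl⟩
    exact hk ⟨i, rfl⟩

end Intertwines

/-! ### Conjugation and embeddings as relabellings -/

/-- Conjugation by `z` relabels the points by the permutation of `z`. -/
theorem intertwines_conj (z x : Wreath Γ α) :
    Intertwines z.right.toEmbedding (fun i => z.left (z.right (x.right⁻¹ i))) x (z * x * z⁻¹) where
  right i := by simp
  left i := by
    have h : (z * x).right⁻¹ (z.right i) = x.right⁻¹ i := by simp
    simp only [Equiv.coe_toEmbedding]
    rw [mul_left_apply, mul_left_apply, inv_left_apply, h]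
    simp
  notMem_supp j hj := by simp at hj

theorem isConj_of_intertwines {e : α ≃ α} {h : α → Γ} {x y : Wreath Γ α}
    (H : Intertwines e.toEmbedding h x y) : IsConj x y := by
  -- `Intertwines` treats the entry at `i` as transport from `i` to `σ i`, while in the
  -- multiplication law the entry at `j` belongs to the arrow ending at `j`. This accounts for the
  -- shift by `x.right`.
  refine isConj_iff.2 ⟨⟨fun j => h (x.right (e.symm j)), e⟩, ?_⟩
  rw [mul_inv_eq_iff_eq_mul]
  have hr (i : α) : y.right (e i) = e (x.right i) := H.right i
  have hl (i : α) : y.left (e i) * h i = h (x.right i) * x.left i := H.left i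
  apply SemidirectProduct.ext
  · funext j
    obtain ⟨i, rfl⟩ := e.surjective j
    rw [mul_left_apply, mul_left_apply]
    have h1 : y.right⁻¹ (e i) = e (x.right⁻¹ i) := by
      rw [Equiv.Perm.inv_eq_iff_eq, hr]; simp
    simp [h1, hl]
  · ext i
    simp [hr]

/-- The hom `Γ ≀ Sym(α) → Γ ≀ Sym(β)` induced by an embedding of the index sets: extend by
trivial points. -/
def embedHom (Γ : Type*) [Group Γ] (e : α ↪ β) : Wreath Γ α →* Wreath Γ β where
  toFun x := ⟨Function.extend e x.left 1, Equiv.Perm.viaEmbeddingHom e x.right⟩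
  map_one' := by
    apply SemidirectProduct.ext
    · funext j
      by_cases h : ∃ i, e i = j
      · obtain ⟨i, rfl⟩ := h
        simp [e.injective.extend_apply]
      · simp [Function.extend_apply' _ _ _ h]
    · simp
  map_mul' x y := by
    apply SemidirectProduct.ext
    · funext j
      rw [mul_left_apply]
      have hinv : (Equiv.Perm.viaEmbeddingHom e x.right)⁻¹ = x.right⁻¹.viaEmbedding e :=
        (map_inv (Equiv.Perm.viaEmbeddingHom e) x.right).symm
      simp only [hinv]
      by_cases h : ∃ i, e i = j
      · obtain ⟨i, rfl⟩ := h
        rw [Equiv.Perm.viaEmbedding_apply, e.injective.extend_apply, e.injective.extend_apply,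
          e.injective.extend_apply, mul_left_apply]
      · rw [Equiv.Perm.viaEmbedding_apply_of_notMem _ _ _ h, Function.extend_apply' _ _ _ h,
          Function.extend_apply' _ _ _ h, Function.extend_apply' _ _ _ h]
        simp
    · simp

theorem intertwines_embedHom (e : α ↪ β) (x : Wreath Γ α) :
    Intertwines e 1 x (embedHom Γ e x) where
  right i := Equiv.Perm.viaEmbedding_apply _ _ _
  left i := by simp [embedHom, e.injective.extend_apply]
  notMem_supp j hj := WreathFH.notMem_supp.2
    ⟨Equiv.Perm.viaEmbedding_apply_of_notMem _ _ _ hj, Function.extend_apply' _ _ _ hj⟩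

theorem eq_embedHom {e : α ↪ β} {x : Wreath Γ α} {y : Wreath Γ β} (H : Intertwines e 1 x y) :
    y = embedHom Γ e x := by
  have H' := intertwines_embedHom e x
  apply SemidirectProduct.ext
  · funext j
    by_cases h : j ∈ Set.range e
    · obtain ⟨i, rfl⟩ := h
      have h1 := H.left i
      have h2 := H'.left i
      simp only [Pi.one_apply, mul_one, one_mul] at h1 h2
      rw [h1, h2]
    · rw [(notMem_supp.1 (H.notMem_supp j h)).2, (notMem_supp.1 (H'.notMem_supp j h)).2]
  · ext j
    by_cases h : j ∈ Set.range e
    · obtain ⟨i, rfl⟩ := h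
      rw [H.right, H'.right]
    · rw [(notMem_supp.1 (H.notMem_supp j h)).1, (notMem_supp.1 (H'.notMem_supp j h)).1]

theorem embedHom_injective (e : α ↪ β) : Function.Injective (embedHom Γ e) := by
  intro x y hxy
  have Hx := intertwines_embedHom e x
  have Hy := intertwines_embedHom e y
  rw [← hxy] at Hy
  apply SemidirectProduct.ext
  · funext i
    have h1 := Hx.left i
    have h2 := Hy.left i
    simp only [Pi.one_apply, mul_one, one_mul] at h1 h2
    rw [← h1, ← h2]
  · ext i
    exact e.injective ((Hx.right i).symm.trans (Hy.right i))

theorem apply_mem_of_supp_subset {y : Wreath Γ β} {S : Set β} (h : supp y ⊆ S) (j : β) :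
    y.right j ∈ S ↔ j ∈ S := by
  by_cases hj : y.right j = j
  · rw [hj]
  · have h1 : j ∈ S := h (Or.inl hj)
    have h2 : y.right j ∈ S := h (Or.inl fun h' => hj (y.right.injective h'))
    simp [h1, h2]

theorem exists_embedHom_eq (e : α ↪ β) {y : Wreath Γ β} (h : supp y ⊆ Set.range e) :
    ∃ x, embedHom Γ e x = y := by
  let f : α ≃ Set.range e := Equiv.ofInjective e e.injective
  have hf (j : Set.range e) : e (f.symm j) = j := Equiv.apply_ofInjective_symm e.injective j
  refine ⟨⟨fun i => y.left (e i),
    f.symm.permCongr (y.right.subtypePerm (p := (· ∈ Set.range e)) fun j =>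
      apply_mem_of_supp_subset h j)⟩, ?_⟩
  refine (eq_embedHom ⟨fun i => ?_, fun i => by simp, fun j hj h' => hj (h h')⟩).symm
  simp only [Equiv.permCongr_apply, hf]
  rfl

theorem extend_eq_embedHom (n : ℕ) (x : WreathFin Γ n) :
    extend Γ n x = embedHom Γ Fin.valEmbedding x := by
  apply eq_embedHom
  refine ⟨fun i => ?_, fun i => ?_, fun j hj => ?_⟩
  · exact Equiv.Perm.extendDomain_apply_image x.right Fin.equivSubtype i
  · simp [extend]
  · have h : ¬ j < n := fun h => hj ⟨⟨j, h⟩, rfl⟩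
    rw [notMem_supp]
    exact ⟨Equiv.Perm.extendDomain_apply_not_subtype x.right Fin.equivSubtype h, dif_neg h⟩

/-! ### Normal form: disjoint cycles on copies of `ZMod k` -/

/-- The product of disjoint cycles of lengths `k i` with cycle-products `p i`. -/
def model (k : ι → ℕ+) (p : ι → Γ) : Wreath Γ (Σ i, ZMod (k i)) :=
  ⟨fun j => if j.2 + 1 = 0 then p j.1 else 1,
    Equiv.sigmaCongrRight fun _ => Equiv.addRight 1⟩

theorem model_right (k : ι → ℕ+) (p : ι → Γ) (i : ι) (s : ZMod (k i)) :
    (model k p).right ⟨i, s⟩ = ⟨i, s + 1⟩ := rfl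

theorem model_left (k : ι → ℕ+) (p : ι → Γ) (i : ι) (s : ZMod (k i)) :
    (model k p).left ⟨i, s⟩ = if s + 1 = 0 then p i else 1 := rfl

theorem model_right_pow (k : ι → ℕ+) (p : ι → Γ) (i : ι) (s : ZMod (k i)) (n : ℕ) :
    ((model k p).right ^ n) ⟨i, s⟩ = ⟨i, s + n⟩ := by
  induction n with
  | zero => simp
  | succ n ih =>
    rw [pow_succ', Equiv.Perm.mul_apply, ih, model_right, Nat.cast_succ, add_assoc]

theorem model_sameCycle (k : ι → ℕ+) (p : ι → Γ) (a b : Σ i, ZMod (k i)) :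
    (model k p).right.SameCycle a b ↔ b.1 = a.1 := by
  constructor
  · rintro ⟨n, rfl⟩
    have hpow (m : ℕ) (c : Σ i, ZMod (k i)) : (((model k p).right ^ m) c).1 = c.1 := by
      obtain ⟨i, s⟩ := c
      rw [model_right_pow]
    cases n with
    | ofNat n => exact_mod_cast hpow n a
    | negSucc n =>
      have h := hpow (n + 1) (((model k p).right ^ (n + 1))⁻¹ a)
      rw [← Equiv.Perm.mul_apply, mul_inv_cancel, Equiv.Perm.one_apply] at h
      rw [zpow_negSucc, h]
  · obtain ⟨i, s⟩ := a
    obtain ⟨j, t⟩ := b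
    rintro h
    obtain rfl : j = i := h
    refine ⟨((t - s).val : ℕ), ?_⟩
    rw [zpow_natCast, model_right_pow, ZMod.natCast_zmod_val]
    simp

theorem model_cycle_ncard (k : ι → ℕ+) (i : ι) :
    Set.ncard {j : Σ i, ZMod (k i) | j.1 = i} = k i := by
  have h : {j : Σ i, ZMod (k i) | j.1 = i} = Set.range (Sigma.mk i) := by
    ext ⟨j, s⟩
    constructor
    · intro h
      obtain rfl : j = i := h
      exact ⟨s, rfl⟩
    · rintro ⟨t, ht⟩
      exact (congrArg Sigma.fst ht).symm
  rw [h, ← Set.image_univ, Set.ncard_image_of_injective _ sigma_mk_injective, Set.ncard_univ,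
    Nat.card_zmod]

theorem model_minimalPeriod (k : ι → ℕ+) (p : ι → Γ) (j : Σ i, ZMod (k i)) :
    Function.minimalPeriod (model k p).right j = k j.1 := by
  obtain ⟨i, s⟩ := j
  have key (n : ℕ) : Function.IsPeriodicPt (model k p).right n ⟨i, s⟩ ↔ (k i : ℕ) ∣ n := by
    rw [Function.IsPeriodicPt, Function.IsFixedPt, ← Equiv.Perm.coe_pow, model_right_pow,
      ← ZMod.natCast_eq_zero_iff]
    simp
  apply Nat.dvd_antisymm
  · rw [← Function.isPeriodicPt_iff_minimalPeriod_dvd, key]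
  · rw [← key]
    exact Function.isPeriodicPt_minimalPeriod _ _

/-- The class of the cycle-product is constant along a cycle. -/
theorem mk_cycleProduct_sameCycle (x : Wreath Γ α) {i j : α} (h : x.right.SameCycle i j) :
    ConjClasses.mk (cycleProduct x j) = ConjClasses.mk (cycleProduct x i) := by
  -- An element intertwines itself along its own permutation, with its own entries as the rescaling;
  -- this moves the starting point one step along the cycle.
  have H : Intertwines x.right.toEmbedding x.left x x :=
    ⟨fun _ => rfl, fun _ => rfl, fun j hj => by simp at hj⟩
  have hpow (m : ℕ) (i : α) : ConjClasses.mk (cycleProduct x ((x.right ^ m) i)) =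
      ConjClasses.mk (cycleProduct x i) := by
    induction m with
    | zero => simp
    | succ m ih =>
      rw [pow_succ', Equiv.Perm.mul_apply, ← ih]
      exact H.mk_cycleProduct _
  obtain ⟨n, rfl⟩ := h
  cases n with
  | ofNat n => exact_mod_cast hpow n i
  | negSucc n =>
    have h := hpow (n + 1) ((x.right ^ (n + 1))⁻¹ i)
    rw [← Equiv.Perm.mul_apply, mul_inv_cancel, Equiv.Perm.one_apply] at h
    rw [zpow_negSucc, h]

/-- Starting at `0`, the only possibly nontrivial entry, at `-1`, is met in the last step. -/
theorem model_cycleProduct_zero (k : ι → ℕ+) (p : ι → Γ) (i : ι) :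
    cycleProduct (model k p) ⟨i, 0⟩ = p i := by
  rw [cycleProduct_eq, model_minimalPeriod]
  have h (s : ℕ) (hs : s < k i) : partialProduct (model k p) s ⟨i, 0⟩ = 1 := by
    induction s with
    | zero => simp
    | succ s ih =>
      rw [partialProduct_succ, ih (by omega), model_right_pow, model_left, if_neg, mul_one]
      rw [zero_add, ← Nat.cast_succ, ZMod.natCast_eq_zero_iff]
      exact Nat.not_dvd_of_pos_of_lt (Nat.succ_pos _) hs
  obtain ⟨m, hm⟩ : ∃ m, (k i : ℕ) = m + 1 := ⟨_, (Nat.succ_pred_eq_of_pos (k i).pos).symm⟩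
  simp only [hm]
  rw [partialProduct_succ, h m (by omega), model_right_pow, model_left, if_pos, mul_one]
  rw [zero_add, ← Nat.cast_succ, ZMod.natCast_eq_zero_iff, hm]

theorem model_mk_cycleProduct (k : ι → ℕ+) (p : ι → Γ) (j : Σ i, ZMod (k i)) :
    ConjClasses.mk (cycleProduct (model k p) j) = ConjClasses.mk (p j.1) := by
  rw [← model_cycleProduct_zero k p j.1]
  exact mk_cycleProduct_sameCycle _ ((model_sameCycle _ _ _ _).2 rfl)

theorem numCycles_model (k : ι → ℕ+) (p : ι → Γ) (r : ℕ) (c : ConjClasses Γ) :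
    numCycles (model k p) r c = Set.ncard {i | (k i : ℕ) = r ∧ ConjClasses.mk (p i) = c} := by
  have hinj : Function.Injective fun i : ι => {j : Σ i, ZMod (k i) | j.1 = i} := by
    intro i i' h
    have h1 : (⟨i, 0⟩ : Σ i, ZMod (k i)) ∈ {j : Σ i, ZMod (k i) | j.1 = i} := rfl
    simp only at h
    rw [h] at h1
    exact h1
  rw [← Set.ncard_image_of_injective _ hinj, numCycles]
  congr 1
  ext s
  constructor
  · rintro ⟨j, rfl, hr, hc⟩
    simp only [model_sameCycle, model_cycle_ncard, model_mk_cycleProduct] at hr hc ⊢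
    exact ⟨j.1, ⟨hr, hc⟩, rfl⟩
  · rintro ⟨i, ⟨hr, hc⟩, rfl⟩
    refine ⟨⟨i, 0⟩, ?_, ?_, ?_⟩
    · simp only [model_sameCycle]
    · rw [← hr]; exact model_cycle_ncard k i
    · rw [model_mk_cycleProduct, hc]

theorem intertwines_model_of_conj (k : ι → ℕ+) {p p' : ι → Γ} {u : ι → Γ}
    (h : ∀ i, p' i * u i = u i * p i) :
    Intertwines (Function.Embedding.refl _) (fun j => u j.1) (model k p) (model k p') where
  right i := rfl
  left j := by
    obtain ⟨i, s⟩ := j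
    simp only [Function.Embedding.refl_apply, model_left, model_right]
    split_ifs
    · exact h i
    · simp
  notMem_supp j hj := by simp at hj

theorem exists_intertwines_model_reindex (k : ι → ℕ+) (p : ι → Γ) (k' : κ → ℕ+) (p' : κ → Γ)
    (f : ι ≃ κ) (hk : ∀ i, k' (f i) = k i) (hp : ∀ i, p' (f i) = p i) :
    ∃ (e : (Σ i, ZMod (k i)) ≃ Σ i, ZMod (k' i)) (h : (Σ i, ZMod (k i)) → Γ),
      Intertwines e.toEmbedding h (model k p) (model k' p') := by
  obtain rfl : k = k' ∘ f := funext fun i => (hk i).symm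
  obtain rfl : p = p' ∘ f := funext fun i => (hp i).symm
  refine ⟨Equiv.sigmaCongrLeft (β := fun i => ZMod (k' i)) f, 1, ?_, ?_, ?_⟩
  · rintro ⟨i, s⟩; rfl
  · rintro ⟨i, s⟩
    simp only [Pi.one_apply, mul_one, one_mul]
    rfl
  · intro j hj; simp at hj

/-- Every element is conjugate to a product of disjoint cycles in normal form. -/
theorem exists_intertwines_model_cycleProduct [Finite α] (x : Wreath Γ α) :
    ∃ (k : Quotient (Equiv.Perm.SameCycle.setoid x.right) → ℕ+)
      (p : Quotient (Equiv.Perm.SameCycle.setoid x.right) → Γ)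
      (e : (Σ i, ZMod (k i)) ≃ α) (h : (Σ i, ZMod (k i)) → Γ),
      Intertwines e.toEmbedding h (model k p) x := by
  set σ := x.right
  have hpos (a : α) : 0 < Function.minimalPeriod σ a :=
    Function.minimalPeriod_pos_of_mem_periodicPts
      (Function.Injective.mem_periodicPts σ.injective a)
  let b : Quotient (Equiv.Perm.SameCycle.setoid σ) → α := Quotient.out
  let k : Quotient (Equiv.Perm.SameCycle.setoid σ) → ℕ+ := fun q => ⟨_, hpos (b q)⟩
  have hk (q) : (k q : ℕ) = Function.minimalPeriod σ (b q) := rfl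
  let e : (Σ i, ZMod (k i)) → α := fun j => (σ ^ j.2.val) (b j.1)
  have hmod (q) (n : ℕ) : (σ ^ (n % k q)) (b q) = (σ ^ n) (b q) := by
    rw [hk, Equiv.Perm.coe_pow, Equiv.Perm.coe_pow, Function.iterate_mod_minimalPeriod_eq]
  have hcast (q) (n : ℕ) : e ⟨q, (n : ZMod (k q))⟩ = (σ ^ n) (b q) := by
    simp only [e, ZMod.val_natCast, hmod]
  have hright (q) (s : ZMod (k q)) : e ⟨q, s + 1⟩ = σ (e ⟨q, s⟩) := by
    have h1 : s + 1 = ((s.val + 1 : ℕ) : ZMod (k q)) := by simp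
    rw [h1, hcast, pow_succ', Equiv.Perm.mul_apply]
  have hmk (q) (s : ZMod (k q)) : (Quotient.mk _ (e ⟨q, s⟩) :
      Quotient (Equiv.Perm.SameCycle.setoid σ)) = q := by
    conv_rhs => rw [← Quotient.out_eq q]
    apply Quotient.sound
    exact (Equiv.Perm.SameCycle.symm ⟨(s.val : ℤ), by simp only [e, b, zpow_natCast]⟩)
  have hinj : Function.Injective e := by
    rintro ⟨q, s⟩ ⟨q', t⟩ h
    obtain rfl : q = q' := by rw [← hmk q s, ← hmk q' t, h]
    congr 1
    apply ZMod.val_injective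
    have h1 : (σ ^ s.val) (b q) = (σ ^ t.val) (b q) := h
    rw [Equiv.Perm.coe_pow, Equiv.Perm.coe_pow] at h1
    exact Function.iterate_injOn_Iio_minimalPeriod (ZMod.val_lt s) (ZMod.val_lt t) h1
  have hsurj : Function.Surjective e := by
    intro a
    have h1 : σ.SameCycle (b (Quotient.mk _ a)) a :=
      Quotient.mk_out (s := Equiv.Perm.SameCycle.setoid σ) a
    obtain ⟨n, hn⟩ := h1.exists_nat_pow_eq
    exact ⟨⟨Quotient.mk _ a, (n : ZMod _)⟩, (hcast _ _).trans hn⟩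
  -- Rescaling by the partial products from the base point `b q` makes every entry trivial except
  -- the closing one, which collects the whole cycle-product.
  refine ⟨k, fun q => cycleProduct x (b q), Equiv.ofBijective e ⟨hinj, hsurj⟩,
    fun j => partialProduct x j.2.val (b j.1), ?_, ?_, ?_⟩
  · rintro ⟨q, s⟩
    exact (hright q s).symm
  · rintro ⟨q, s⟩
    simp only [model_left, model_right]
    have h1 : x.left (e ⟨q, s⟩) * partialProduct x s.val (b q) =
        partialProduct x (s.val + 1) (b q) := (partialProduct_succ x s.val (b q)).symm
    refine h1.trans ?_
    have h2 : s + 1 = ((s.val + 1 : ℕ) : ZMod (k q)) := by simp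
    have h3 := ZMod.val_lt s
    split_ifs with h
    · rw [h, ZMod.val_zero, partialProduct_zero, one_mul]
      rw [h2, ZMod.natCast_eq_zero_iff] at h
      have h4 : s.val + 1 = k q := le_antisymm h3 (Nat.le_of_dvd (Nat.succ_pos _) h)
      rw [h4, hk, cycleProduct_eq]
    · rw [mul_one, h2, ZMod.val_natCast, Nat.mod_eq_of_lt]
      refine lt_of_le_of_ne h3 fun h4 => h ?_
      rw [h2, ZMod.natCast_eq_zero_iff]
      exact dvd_of_eq h4.symm
  · intro j hj; simp at hj

/-- The product of disjoint cycles of lengths `k i` with cycle-products in the classes `c i`. -/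
def classModel (k : ι → ℕ+) (c : ι → ConjClasses Γ) : Wreath Γ (Σ i, ZMod (k i)) :=
  model k fun i => Quotient.out (c i)

theorem mk_out (c : ConjClasses Γ) : ConjClasses.mk (Quotient.out c) = c := Quotient.out_eq c

theorem exists_intertwines_classModel {α : Type*} [Finite α] (x : Wreath Γ α) :
    ∃ (k : Quotient (Equiv.Perm.SameCycle.setoid x.right) → ℕ+)
      (c : Quotient (Equiv.Perm.SameCycle.setoid x.right) → ConjClasses Γ)
      (e : (Σ i, ZMod (k i)) ≃ α) (h : (Σ i, ZMod (k i)) → Γ),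
      Intertwines e.toEmbedding h (classModel k c) x := by
  obtain ⟨k, p, e, h, H⟩ := exists_intertwines_model_cycleProduct x
  have hc (i) : IsConj (Quotient.out (ConjClasses.mk (p i))) (p i) :=
    ConjClasses.mk_eq_mk_iff_isConj.1 (mk_out _)
  choose u hu using fun i => isConj_iff.1 (hc i)
  have H' := (intertwines_model_of_conj k (p := fun i => Quotient.out (ConjClasses.mk (p i)))
    (p' := p) (u := u) fun i => by
    conv_lhs => rw [← hu i]
    group).trans H
  exact ⟨k, fun i => ConjClasses.mk (p i), e, _, H'⟩

/-! ### The modified type determines the conjugacy class -/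

open Classical in
/-- The length of a cycle with cycle-product in `c` that contributes the part `r` to a modified
type. -/
def cycleLength (c : ConjClasses Γ) (r : ℕ+) : ℕ+ := if c = 1 then r + 1 else r

theorem cycleLength_injective (c : ConjClasses Γ) : Function.Injective (cycleLength c) := by
  intro r s h
  unfold cycleLength at h
  split_ifs at h
  · exact add_right_cancel h
  · exact h

theorem cycleLength_ne (c : ConjClasses Γ) (r : ℕ+) : (cycleLength c r, c) ≠ (1, 1) := by
  intro h
  obtain ⟨h1, h2⟩ := Prod.mk.injEq _ _ _ _ ▸ h
  rw [cycleLength, if_pos h2] at h1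
  exact absurd h1 (PNat.lt_add_left 1 r).ne'

theorem exists_cycleLength {k : ℕ+} {c : ConjClasses Γ} (h : (k, c) ≠ (1, 1)) :
    ∃ r, cycleLength c r = k := by
  unfold cycleLength
  by_cases hc : c = 1
  · have hk : k ≠ 1 := by
      rintro rfl
      exact h (by rw [hc])
    obtain ⟨r, rfl⟩ := PNat.exists_eq_succ_of_ne_one hk
    exact ⟨r, by rw [if_pos hc]⟩
  · exact ⟨k, by rw [if_neg hc]⟩

theorem hasModType_iff_numCycles (x : Wreath Γ α) (ν : ModType Γ) :
    HasModType x ν ↔ ∀ c r, (ν c).count r = numCycles x (cycleLength c r) c := by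
  constructor
  · rintro ⟨h1, h2⟩ c r
    unfold cycleLength
    split_ifs with hc
    · subst hc; exact h1 r
    · exact h2 c hc r
  · intro h
    refine ⟨fun r => ?_, fun c hc r => ?_⟩
    · have := h 1 r
      rwa [cycleLength, if_pos rfl] at this
    · have := h c r
      rwa [cycleLength, if_neg hc] at this

theorem HasModType.unique {x : Wreath Γ α} {ν ν' : ModType Γ} (h₁ : HasModType x ν)
    (h₂ : HasModType x ν') : ν = ν' := by
  rw [hasModType_iff_numCycles] at h₁ h₂
  funext c
  ext r
  rw [h₁, h₂]

/-- The multiset of (length, class of cycle-product) of the nontrivial cycles of an element of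
modified type `ν`. -/
def cycleData [Fintype (ConjClasses Γ)] (ν : ModType Γ) : Multiset (ℕ+ × ConjClasses Γ) :=
  ∑ c, (ν c).map fun r => (cycleLength c r, c)

open Classical in
theorem count_cycleData [Fintype (ConjClasses Γ)] (ν : ModType Γ) (c : ConjClasses Γ) (r : ℕ+) :
    (cycleData ν).count (cycleLength c r, c) = (ν c).count r := by
  rw [cycleData, Multiset.count_sum', Finset.sum_eq_single c]
  · exact Multiset.count_map_eq_count' (fun r => (cycleLength c r, c)) (ν c)
      (fun r s h => cycleLength_injective c (congrArg Prod.fst h)) r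
  · intro c' _ hc'
    rw [Multiset.count_eq_zero]
    intro h
    obtain ⟨s, _, hs⟩ := Multiset.mem_map.1 h
    exact hc' (congrArg Prod.snd hs)
  · simp

theorem notMem_cycleData [Fintype (ConjClasses Γ)] (ν : ModType Γ) : (1, 1) ∉ cycleData ν := by
  rw [cycleData, Multiset.mem_sum]
  rintro ⟨c, _, h⟩
  obtain ⟨s, _, hs⟩ := Multiset.mem_map.1 h
  exact cycleLength_ne c s hs

theorem sum_cycleData [Fintype (ConjClasses Γ)] (ν : ModType Γ) (f : ℕ+ × ConjClasses Γ → ℕ) :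
    ((cycleData ν).map f).sum = ∑ c, ((ν c).map fun r => f (cycleLength c r, c)).sum := by
  rw [cycleData, ← Multiset.coe_mapAddMonoidHom, ← Multiset.coe_sumAddMonoidHom, map_sum, map_sum]
  simp

/-- The number of points moved by an element of modified type `ν`. -/
def supportSize (ν : ModType Γ) : ℕ := degree ν + (ν 1).card

theorem degree_eq_sum [Fintype (ConjClasses Γ)] (ν : ModType Γ) :
    degree ν = ∑ c, ((ν c).map fun k : ℕ+ => (k : ℕ)).sum := by
  rw [degree, finsum_eq_sum_of_fintype]

open Classical in
-- The degree as a sum over cycles: length minus one if the cycle-product is trivial, length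
-- otherwise. In this form it is the codimension of the potentials.
theorem sum_cycleData_sub [Fintype (ConjClasses Γ)] (ν : ModType Γ) :
    ((cycleData ν).map fun j => (j.1 : ℕ) - if j.2 = 1 then 1 else 0).sum = degree ν := by
  rw [sum_cycleData, degree_eq_sum]
  refine Finset.sum_congr rfl fun c _ => ?_
  congr 2
  funext r
  unfold cycleLength
  split_ifs <;> simp

open Classical in
theorem sum_cycleData_fst [Fintype (ConjClasses Γ)] (ν : ModType Γ) :
    ((cycleData ν).map fun j => (j.1 : ℕ)).sum = supportSize ν := by
  have h : ∀ c : ConjClasses Γ, ((ν c).map fun r => ((cycleLength c r : ℕ+) : ℕ)).sum =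
      ((ν c).map fun r : ℕ+ => (r : ℕ)).sum + if c = 1 then (ν 1).card else 0 := by
    intro c
    by_cases hc : c = 1
    · subst hc
      simp [cycleLength, Multiset.sum_map_add]
    · simp [cycleLength, hc]
  rw [sum_cycleData]
  simp only [h]
  rw [Finset.sum_add_distrib, Finset.sum_ite_eq' Finset.univ (1 : ConjClasses Γ),
    if_pos (Finset.mem_univ _), supportSize, degree_eq_sum]

open Classical in
/-- The nontrivial cycles among those prescribed by `k` and `c`. -/
def nontrivialData [Fintype ι] (k : ι → ℕ+) (c : ι → ConjClasses Γ) :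
    Multiset (ℕ+ × ConjClasses Γ) :=
  (Finset.univ.val.map fun i => (k i, c i)).filter (· ≠ (1, 1))

/-- The pairs `(cycleLength d r, d)` are exactly the pairs other than `(1, 1)`, so the counts in a
modified type determine all multiplicities of nontrivial cycles. -/
theorem hasModType_classModel_iff [Fintype (ConjClasses Γ)] [Fintype ι] (k : ι → ℕ+)
    (c : ι → ConjClasses Γ) (ν : ModType Γ) :
    HasModType (classModel k c) ν ↔ nontrivialData k c = cycleData ν := by
  classical
  have key (r : ℕ+) (d : ConjClasses Γ) : numCycles (classModel k c) (cycleLength d r) d =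
      (nontrivialData k c).count (cycleLength d r, d) := by
    rw [classModel, numCycles_model, nontrivialData,
      Multiset.count_filter_of_pos (p := (· ≠ (1, 1))) (cycleLength_ne d r), Multiset.count_map]
    simp only [mk_out, PNat.coe_inj]
    rw [Set.ncard_eq_toFinset_card', Finset.card_def]
    congr 1
    rw [Set.toFinset_ofPred, Finset.filter_val]
    refine Multiset.filter_congr fun i _ => ?_
    rw [Prod.mk.injEq]
    tauto
  rw [hasModType_iff_numCycles]
  constructor
  · intro h
    ext ⟨l, d⟩
    by_cases hl : (l, d) = (1, 1)
    · rw [hl, Multiset.count_eq_zero.2 (notMem_cycleData ν), Multiset.count_eq_zero]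
      simp [nontrivialData]
    · obtain ⟨r, rfl⟩ := exists_cycleLength hl
      rw [← key, ← h, count_cycleData]
  · intro h d r
    rw [key, h, count_cycleData]

theorem Intertwines.card_supp {e : α ↪ β} {h : α → Γ} {x : Wreath Γ α} {y : Wreath Γ β}
    (H : Intertwines e h x y) : (supp y).ncard = (supp x).ncard := by
  rw [← H.image_supp, Set.ncard_image_of_injective _ e.injective]

theorem out_eq_one_iff (c : ConjClasses Γ) : Quotient.out c = 1 ↔ c = 1 := by
  constructor
  · intro h
    rw [← mk_out c, h]; rfl
  · rintro rfl
    have h : IsConj (Quotient.out (1 : ConjClasses Γ)) 1 :=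
      ConjClasses.mk_eq_mk_iff_isConj.1 (mk_out _)
    exact isConj_one_left.1 h

theorem notMem_supp_classModel (k : ι → ℕ+) (c : ι → ConjClasses Γ) (i : ι) (s : ZMod (k i)) :
    (⟨i, s⟩ : Σ i, ZMod (k i)) ∉ supp (classModel k c) ↔ (k i, c i) = (1, 1) := by
  have hk : (1 : ZMod (k i)) = 0 ↔ k i = 1 := by
    rw [← Nat.cast_one, ZMod.natCast_eq_zero_iff, Nat.dvd_one, ← PNat.one_coe, PNat.coe_inj]
  rw [notMem_supp, classModel, model_right, model_left, Prod.mk.injEq, ← hk]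
  simp only [Sigma.mk.injEq, heq_eq_eq, true_and, add_eq_left]
  refine and_congr_right fun h => ?_
  have : Subsingleton (ZMod (k i)) := by
    rw [hk.1 h]; exact inferInstanceAs (Subsingleton (ZMod 1))
  rw [if_pos (Subsingleton.elim _ _), out_eq_one_iff]

theorem ncard_supp_classModel [Fintype ι] (k : ι → ℕ+) (c : ι → ConjClasses Γ) :
    (supp (classModel k c)).ncard = ((nontrivialData k c).map fun j => (j.1 : ℕ)).sum := by
  classical
  have h : supp (classModel k c) = ((Finset.univ.filter fun i => (k i, c i) ≠ (1, 1)).sigma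
      fun i => (Finset.univ : Finset (ZMod (k i))) : Finset (Σ i, ZMod (k i))) := by
    ext ⟨i, s⟩
    have := notMem_supp_classModel k c i s
    rw [← not_iff_not, this]
    simp
  rw [h, Set.ncard_coe_finset, Finset.card_sigma, nontrivialData, Multiset.filter_map,
    Multiset.map_map]
  simp only [Finset.card_univ, ZMod.card]
  rfl

theorem HasModType.ncard_supp_of_finite [Finite Γ] [Finite α] {x : Wreath Γ α} {ν : ModType Γ}
    (h : HasModType x ν) : (supp x).ncard = supportSize ν := by
  have := Fintype.ofFinite (ConjClasses Γ)
  obtain ⟨k, c, e, u, H⟩ := exists_intertwines_classModel x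
  have := Fintype.ofFinite (Quotient (Equiv.Perm.SameCycle.setoid x.right))
  rw [H.card_supp, ncard_supp_classModel,
    (hasModType_classModel_iff k c ν).1 ((H.hasModType_iff ν).1 h), sum_cycleData_fst]

open Classical in
theorem map_eq_nontrivialData_add [Fintype ι] (k : ι → ℕ+) (c : ι → ConjClasses Γ) :
    (Finset.univ.val.map fun i => (k i, c i)) = nontrivialData k c +
      Multiset.replicate ((Finset.univ.val.map fun i => (k i, c i)).count (1, 1)) (1, 1) := by
  conv_lhs => rw [← Multiset.filter_add_not (· ≠ (1, 1)) (Finset.univ.val.map fun i => (k i, c i))]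
  simp only [not_not, Multiset.filter_eq', nontrivialData]

open Classical in
-- Over an index set of given size, the number of trivial cycles is thereby determined by the
-- nontrivial ones.
theorem card_eq_nontrivialData_add [Fintype ι] (k : ι → ℕ+) (c : ι → ConjClasses Γ) :
    Nat.card (Σ i, ZMod (k i)) = ((nontrivialData k c).map fun j => (j.1 : ℕ)).sum +
      (Finset.univ.val.map fun i => (k i, c i)).count (1, 1) := by
  have h := congrArg (fun s => (s.map fun j => (j.1 : ℕ)).sum) (map_eq_nontrivialData_add k c)
  simp only [Multiset.map_add, Multiset.sum_add, Multiset.map_replicate, Multiset.sum_replicate,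
    Multiset.map_map] at h
  rw [Nat.card_eq_fintype_card, Fintype.card_sigma]
  simp only [ZMod.card]
  refine Eq.trans ?_ (h.trans ?_)
  · rfl
  · simp

theorem exists_equiv_of_map_eq {δ : Type*} [Fintype ι] [Fintype κ] {f : ι → δ} {g : κ → δ}
    (h : Finset.univ.val.map f = Finset.univ.val.map g) : ∃ e : ι ≃ κ, ∀ i, g (e i) = f i := by
  classical
  have key (d : δ) : Nonempty ({i // f i = d} ≃ {i // g i = d}) := by
    have := congrArg (Multiset.count d) h
    rw [Multiset.count_map, Multiset.count_map] at this
    refine Fintype.card_eq.1 ?_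
    rw [Fintype.card_subtype, Fintype.card_subtype, Finset.card_def, Finset.card_def,
      Finset.filter_val, Finset.filter_val]
    simpa only [eq_comm (a := d)] using this
  exact ⟨Equiv.ofFiberEquiv fun d => (key d).some, Equiv.ofFiberEquiv_map _⟩

/-- Elements of the same modified type over the same finite index set are conjugate. -/
theorem HasModType.isConj [Finite Γ] [Finite α] {x y : Wreath Γ α} {ν : ModType Γ}
    (hx : HasModType x ν) (hy : HasModType y ν) : IsConj x y := by
  classical
  have := Fintype.ofFinite (ConjClasses Γ)
  obtain ⟨k, c, e, u, H⟩ := exists_intertwines_classModel x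
  obtain ⟨k', c', e', u', H'⟩ := exists_intertwines_classModel y
  have := Fintype.ofFinite (Quotient (Equiv.Perm.SameCycle.setoid x.right))
  have := Fintype.ofFinite (Quotient (Equiv.Perm.SameCycle.setoid y.right))
  have h1 := (hasModType_classModel_iff k c ν).1 ((H.hasModType_iff ν).1 hx)
  have h2 := (hasModType_classModel_iff k' c' ν).1 ((H'.hasModType_iff ν).1 hy)
  have h3 := card_eq_nontrivialData_add k c
  have h4 := card_eq_nontrivialData_add k' c'
  rw [h1, Nat.card_congr e] at h3
  rw [h2, Nat.card_congr e', h3] at h4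
  -- Both elements have the same nontrivial cycles and the same number of points, hence as many
  -- trivial cycles; the full lists of cycles agree up to order.
  have h5 := map_eq_nontrivialData_add k c
  rw [h1, add_left_cancel h4, ← h2, ← map_eq_nontrivialData_add] at h5
  obtain ⟨f, hf⟩ := exists_equiv_of_map_eq h5
  obtain ⟨e₀, u₀, H₀⟩ := exists_intertwines_model_reindex k (fun i => Quotient.out (c i)) k'
    (fun i => Quotient.out (c' i)) f (fun i => congrArg Prod.fst (hf i))
    (fun i => congrArg Quotient.out (congrArg Prod.snd (hf i)))
  have H₁ := (H.symm.trans H₀).trans H'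
  exact isConj_of_intertwines (e := (e.symm.trans e₀).trans e') H₁

theorem exists_cycleData_eq [Fintype (ConjClasses Γ)] (N : Multiset (ℕ+ × ConjClasses Γ))
    (hN : (1, 1) ∉ N) : ∃ ν, cycleData ν = N := by
  classical
  induction N using Multiset.induction_on with
  | empty => exact ⟨fun _ => 0, by simp [cycleData]⟩
  | cons j N ih =>
    obtain ⟨k, c⟩ := j
    rw [Multiset.mem_cons, not_or] at hN
    obtain ⟨ν, rfl⟩ := ih hN.2
    obtain ⟨r, rfl⟩ := exists_cycleLength (Ne.symm hN.1)
    refine ⟨fun d => ν d + if d = c then {r} else 0, ?_⟩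
    have h (d : ConjClasses Γ) : ((if d = c then {r} else 0 : Multiset ℕ+).map fun r =>
        (cycleLength d r, d)) = if d = c then {(cycleLength c r, c)} else 0 := by
      split_ifs with hd
      · subst hd; simp
      · simp
    simp only [cycleData, Multiset.map_add, Finset.sum_add_distrib, h]
    rw [Finset.sum_ite_eq' Finset.univ c, if_pos (Finset.mem_univ _), add_comm,
      Multiset.singleton_add]

theorem exists_hasModType [Finite Γ] [Finite α] (x : Wreath Γ α) : ∃ ν, HasModType x ν := by
  have := Fintype.ofFinite (ConjClasses Γ)
  obtain ⟨k, c, e, u, H⟩ := exists_intertwines_classModel x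
  have := Fintype.ofFinite (Quotient (Equiv.Perm.SameCycle.setoid x.right))
  obtain ⟨ν, hν⟩ := exists_cycleData_eq (nontrivialData k c) (by simp [nontrivialData])
  exact ⟨ν, (H.hasModType_iff ν).2 ((hasModType_classModel_iff k c ν).2 hν.symm)⟩

/-- Every modified type is realized over any sufficiently large index set. -/
theorem exists_hasModType_fin [Finite Γ] (ν : ModType Γ) {n : ℕ} (hn : supportSize ν ≤ n) :
    ∃ x : WreathFin Γ n, HasModType x ν := by
  classical
  have := Fintype.ofFinite (ConjClasses Γ)
  -- One cycle for each entry of `cycleData ν`; there is no trivial one, so exactly `supportSize ν`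
  -- points are used.
  let k : (cycleData ν).ToType → ℕ+ := fun i => i.1.1
  let c : (cycleData ν).ToType → ConjClasses Γ := fun i => i.1.2
  have hkc : (Finset.univ.val.map fun i => (k i, c i)) = cycleData ν :=
    Multiset.map_univ_coe (cycleData ν)
  have hnd : nontrivialData k c = cycleData ν := by
    rw [nontrivialData, hkc, Multiset.filter_eq_self]
    rintro j hj rfl
    exact notMem_cycleData ν hj
  have hcard : Fintype.card (Σ i, ZMod (k i)) ≤ Fintype.card (Fin n) := by
    rw [← Nat.card_eq_fintype_card, card_eq_nontrivialData_add k c, hnd, sum_cycleData_fst, hkc,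
      Multiset.count_eq_zero.2 (notMem_cycleData ν), Fintype.card_fin]
    exact hn
  obtain ⟨e⟩ := Function.Embedding.nonempty_of_card_le hcard
  exact ⟨embedHom Γ e (classModel k c), ((intertwines_embedHom e _).hasModType_iff ν).2
    ((hasModType_classModel_iff k c ν).2 hnd)⟩

/-! ### Systems of two-term equations over a group with zero -/

/-- The solutions of a system of equations `a φ(i) = b φ(j)`. -/
def solutions {V G E : Type*} [Mul G] (eqs : E → (V × G) × V × G) : Set (V → G) :=
  {φ | ∀ t, (eqs t).1.2 * φ (eqs t).1.1 = (eqs t).2.2 * φ (eqs t).2.1}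

/-- One equation `a φ(i) = b φ(j)` allows to eliminate one variable. -/
theorem exists_elimination {V G : Type*} [GroupWithZero G] [Nontrivial V] (i j : V) (a b : G) :
    ∃ (i₀ : V) (f : V → {v // v ≠ i₀}) (c : V → G),
      Function.Injective (fun (ψ : {v // v ≠ i₀} → G) v => c v * ψ (f v)) ∧
      ∀ ψ : {v // v ≠ i₀} → G, a * (c i * ψ (f i)) = b * (c j * ψ (f j)) := by
  classical
  have build (i₀ : V) (w : {v // v ≠ i₀}) (d : G)
      (h : ∀ ψ : {v // v ≠ i₀} → G,
        a * ((if i = i₀ then d else 1) * ψ (if h : i ≠ i₀ then ⟨i, h⟩ else w)) =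
        b * ((if j = i₀ then d else 1) * ψ (if h : j ≠ i₀ then ⟨j, h⟩ else w))) :
      ∃ (i₀ : V) (f : V → {v // v ≠ i₀}) (c : V → G),
        Function.Injective (fun (ψ : {v // v ≠ i₀} → G) v => c v * ψ (f v)) ∧
        ∀ ψ : {v // v ≠ i₀} → G, a * (c i * ψ (f i)) = b * (c j * ψ (f j)) := by
    refine ⟨i₀, fun v => if h : v ≠ i₀ then ⟨v, h⟩ else w, fun v => if v = i₀ then d else 1, ?_, h⟩
    intro ψ ψ' hψ
    funext v
    have := congrFun hψ v.1
    simpa [v.2] using this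
  by_cases ha : a = 0
  · obtain ⟨w, hw⟩ := exists_ne j
    exact build j ⟨w, hw⟩ 0 fun ψ => by simp [ha]
  by_cases hij : i = j
  · obtain ⟨w, hw⟩ := exists_ne i
    exact build i ⟨w, hw⟩ 0 fun ψ => by simp [← hij]
  · refine build i ⟨j, Ne.symm hij⟩ (a⁻¹ * b) fun ψ => ?_
    have hji : j ≠ i := Ne.symm hij
    simp [hji, ← mul_assoc, ha]

/-- Elimination without addition: solving one equation for one variable leaves a system of the same
shape with one equation and one variable less. When at most one variable is left, the zero solution
suffices. -/
theorem card_pow_le_card_solutions_mul {G : Type*} [GroupWithZero G] [Finite G] (m : ℕ) :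
    ∀ {V : Type*} [Finite V] (eqs : Fin m → (V × G) × V × G),
      Nat.card G ^ Nat.card V ≤ (solutions eqs).ncard * Nat.card G ^ m := by
  have hG : 0 < Nat.card G := Nat.card_pos
  induction m with
  | zero =>
    intro V _ eqs
    have h : solutions eqs = Set.univ := Set.eq_univ_of_forall fun φ t => t.elim0
    rw [h, Set.ncard_univ, Nat.card_fun, pow_zero, mul_one]
  | succ m ih =>
    intro V _ eqs
    cases subsingleton_or_nontrivial V with
    | inl hV =>
      have h0 : (0 : V → G) ∈ solutions eqs := fun t => by simp
      have h1 : 0 < (solutions eqs).ncard := (Set.ncard_pos (Set.toFinite _)).2 ⟨_, h0⟩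
      have h2 : Nat.card V ≤ m + 1 := by
        have := Finite.card_le_one_iff_subsingleton.2 hV
        omega
      calc Nat.card G ^ Nat.card V ≤ Nat.card G ^ (m + 1) := Nat.pow_le_pow_right hG h2
        _ ≤ _ := Nat.le_mul_of_pos_left _ h1
    | inr hV =>
      obtain ⟨i₀, f, c, hinj, hsol⟩ := exists_elimination (eqs 0).1.1 (eqs 0).2.1 (eqs 0).1.2
        (eqs 0).2.2
      let eqs' : Fin m → ({v // v ≠ i₀} × G) × {v // v ≠ i₀} × G := fun t =>
        ((f (eqs t.succ).1.1, (eqs t.succ).1.2 * c (eqs t.succ).1.1),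
          (f (eqs t.succ).2.1, (eqs t.succ).2.2 * c (eqs t.succ).2.1))
      have h1 : (solutions eqs').ncard ≤ (solutions eqs).ncard := by
        refine Set.ncard_le_ncard_of_injOn _ (fun ψ hψ => ?_) hinj.injOn (Set.toFinite _)
        intro t
        refine Fin.cases (hsol ψ) (fun t => ?_) t
        have := hψ t
        simpa only [eqs', mul_assoc] using this
      have h2 : Nat.card V = Nat.card {v // v ≠ i₀} + 1 := by
        classical
        have := Fintype.ofFinite V
        rw [Nat.card_eq_fintype_card, Nat.card_eq_fintype_card, Fintype.card_subtype_compl,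
          Fintype.card_subtype_eq]
        have := Fintype.card_pos_iff.2 ⟨i₀⟩
        omega
      rw [h2, pow_succ, pow_succ, ← mul_assoc]
      exact Nat.mul_le_mul_right _ ((ih eqs').trans (Nat.mul_le_mul_right _ h1))

/-! ### Potentials and additive degree -/

/-- The fixed points of `x = (g, σ)` on functions with values in `Γ ∪ {0}`. -/
def potentials (x : Wreath Γ α) : Set (α → WithZero Γ) :=
  {φ | ∀ i, φ (x.right i) = (x.left (x.right i) : WithZero Γ) * φ i}

theorem inter_potentials_subset (x y : Wreath Γ α) :
    potentials x ∩ potentials y ⊆ potentials (x * y) := by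
  rintro φ ⟨hx, hy⟩ i
  rw [SemidirectProduct.mul_right, Equiv.Perm.mul_apply, hx, hy, mul_left_apply, ← mul_assoc,
    WithZero.coe_mul]
  simp

/-- Together with the converse below, this makes the potentials detect the support: the delta
function at `j` is fixed exactly when `j` is outside it. -/
theorem notMem_supp_of_single_mem [DecidableEq α] {x : Wreath Γ α} {j : α}
    (h : Pi.single j 1 ∈ potentials x) : j ∉ supp x := by
  have h1 : x.right j = j := by
    by_contra hne
    have := h j
    rw [Pi.single_eq_of_ne hne, Pi.single_eq_same, mul_one] at this
    exact WithZero.coe_ne_zero this.symm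
  have h2 := h j
  rw [h1, Pi.single_eq_same, mul_one] at h2
  exact notMem_supp.2 ⟨h1, WithZero.coe_inj.1 h2.symm⟩

theorem single_mem_potentials [DecidableEq α] {x : Wreath Γ α} {j : α} (h : j ∉ supp x) :
    Pi.single j 1 ∈ potentials x := by
  obtain ⟨h1, h2⟩ := notMem_supp.1 h
  intro i
  by_cases hi : i = j
  · rw [hi, h1, h2]; simp
  · have hi' : x.right i ≠ j := fun h' => hi (x.right.injective (h'.trans h1.symm))
    rw [Pi.single_eq_of_ne hi', Pi.single_eq_of_ne hi, mul_zero]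

theorem Intertwines.mem_potentials_iff {e : α ≃ β} {h : α → Γ} {x : Wreath Γ α} {y : Wreath Γ β}
    (H : Intertwines e.toEmbedding h x y) (ψ : β → WithZero Γ) :
    ψ ∈ potentials y ↔
      (fun i => ((h (x.right i) : Γ) : WithZero Γ)⁻¹ * ψ (e i)) ∈ potentials x := by
  have hr (i : α) : y.right (e i) = e (x.right i) := H.right i
  have hl (i : α) : y.left (e i) = h (x.right i) * x.left i * (h i)⁻¹ := by
    rw [eq_mul_inv_iff_mul_eq]; exact H.left i
  have key : ψ ∈ potentials y ↔
      ∀ i, ψ (y.right (e i)) = (y.left (y.right (e i)) : WithZero Γ) * ψ (e i) :=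
    e.surjective.forall
  rw [key]
  refine forall_congr' fun i => ?_
  rw [hr, hl, inv_mul_eq_iff_eq_mul₀ WithZero.coe_ne_zero]
  simp only [WithZero.coe_mul, WithZero.coe_inv, mul_assoc]

/-- Going once round from `-1`, every step but the last has trivial entry, so `φ` is constant. The
last step, back into `-1`, gives `φ = g φ` with `g` the representative of `c i`; for `g ≠ 1` this
forces `φ = 0`, as `Γ` acts freely on itself. -/
theorem mem_potentials_classModel_iff (k : ι → ℕ+) (c : ι → ConjClasses Γ)
    (φ : (Σ i, ZMod (k i)) → WithZero Γ) :
    φ ∈ potentials (classModel k c) ↔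
      ∀ i (s : ZMod (k i)), φ ⟨i, s⟩ = φ ⟨i, -1⟩ ∧ (c i ≠ 1 → φ ⟨i, -1⟩ = 0) := by
  constructor
  · intro h i
    have hstep (s : ZMod (k i)) : φ ⟨i, s + 1⟩ =
        ((if s + 1 + 1 = 0 then Quotient.out (c i) else 1 : Γ) : WithZero Γ) * φ ⟨i, s⟩ :=
      h ⟨i, s⟩
    have hlt (n : ℕ) (hn : n < k i) : φ ⟨i, -1 + n⟩ = φ ⟨i, -1⟩ := by
      induction n with
      | zero => simp
      | succ n ih =>
        rw [Nat.cast_succ, ← add_assoc, hstep, if_neg, ih (by omega), WithZero.coe_one, one_mul]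
        have h1 : (-1 + n + 1 + 1 : ZMod (k i)) = ((n + 1 : ℕ) : ZMod (k i)) := by
          push_cast; ring
        rw [h1, ZMod.natCast_eq_zero_iff]
        exact Nat.not_dvd_of_pos_of_lt (Nat.succ_pos _) hn
    have hconst (s : ZMod (k i)) : φ ⟨i, s⟩ = φ ⟨i, -1⟩ := by
      have := hlt (s + 1).val (ZMod.val_lt _)
      rwa [ZMod.natCast_zmod_val, neg_add_cancel_comm_assoc] at this
    refine fun s => ⟨hconst s, fun hc => ?_⟩
    have h1 := hstep (-1 - 1)
    rw [if_pos (by ring), hconst, hconst (-1 - 1)] at h1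
    by_contra h2
    have h3 := (mul_eq_right₀ h2).1 h1.symm
    exact hc ((out_eq_one_iff _).1 (WithZero.coe_inj.1 h3))
  · rintro h ⟨i, s⟩
    change φ ⟨i, s + 1⟩ =
      ((if s + 1 + 1 = 0 then Quotient.out (c i) else 1 : Γ) : WithZero Γ) * φ ⟨i, s⟩
    rw [(h i (s + 1)).1, (h i s).1]
    split_ifs
    · by_cases hc : c i = 1
      · rw [(out_eq_one_iff _).2 hc]; simp
      · rw [(h i s).2 hc]; simp
    · simp

open Classical in
theorem HasModType.degree_eq_of_classModel [Fintype (ConjClasses Γ)] [Fintype ι] {k : ι → ℕ+}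
    {c : ι → ConjClasses Γ} {ν : ModType Γ} (h : HasModType (classModel k c) ν) :
    degree ν = ∑ i, ((k i : ℕ) - if c i = 1 then 1 else 0) := by
  have h1 := congrArg (fun s => (s.map fun j : ℕ+ × ConjClasses Γ =>
    (j.1 : ℕ) - if j.2 = 1 then 1 else 0).sum) (map_eq_nontrivialData_add k c)
  simp only [Multiset.map_add, Multiset.sum_add, Multiset.map_replicate, Multiset.sum_replicate,
    Multiset.map_map] at h1
  rw [(hasModType_classModel_iff k c ν).1 h, sum_cycleData_sub] at h1
  simpa using h1.symm

/-- The potentials of an element of modified type `ν` are cut out by `‖ν‖` equations. -/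
theorem HasModType.exists_equations [Finite Γ] [Finite α] {x : Wreath Γ α} {ν : ModType Γ}
    (h : HasModType x ν) :
    (∃ eqs : Fin (degree ν) → (α × WithZero Γ) × α × WithZero Γ, potentials x = solutions eqs) ∧
      (potentials x).ncard * Nat.card (WithZero Γ) ^ degree ν ≤
        Nat.card (WithZero Γ) ^ Nat.card α := by
  classical
  have : Finite (WithZero Γ) := inferInstanceAs (Finite (Option Γ))
  have := Fintype.ofFinite (ConjClasses Γ)
  obtain ⟨k, c, e, u, H⟩ := exists_intertwines_classModel x
  have := Fintype.ofFinite (Quotient (Equiv.Perm.SameCycle.setoid x.right))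
  have hdeg := HasModType.degree_eq_of_classModel ((H.hasModType_iff ν).1 h)
  have hmem (ψ : α → WithZero Γ) := (H.mem_potentials_iff ψ).trans
    (mem_potentials_classModel_iff k c _)
  set v : (Σ i, ZMod (k i)) → WithZero Γ := fun j => ((u ((classModel k c).right j) : Γ) :
    WithZero Γ)⁻¹
  have hv0 (j) : v j ≠ 0 := inv_ne_zero WithZero.coe_ne_zero
  constructor
  -- One equation per point, omitting the base point `-1` of each cycle with trivial cycle-product:
  -- `‖ν‖` equations in all. On the other cycles the equation `1 * φ = 0 * φ` expresses vanishing.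
  · let E := Σ i, {s : ZMod (k i) // s ≠ -1 ∨ c i ≠ 1}
    have hE : Fintype.card E = degree ν := by
      rw [hdeg, Fintype.card_sigma]
      refine Finset.sum_congr rfl fun i _ => ?_
      by_cases hc : c i = 1
      · simp only [hc, ne_eq, not_true_eq_false, or_false, if_true]
        rw [Fintype.card_subtype_compl, Fintype.card_subtype_eq, ZMod.card]
      · simp only [hc, ne_eq, not_false_eq_true, or_true, if_false]
        rw [Fintype.card_subtype_true, ZMod.card, Nat.sub_zero]
    let eqE : E → (α × WithZero Γ) × α × WithZero Γ := fun j =>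
      if c j.1 = 1 then
        ((e ⟨j.1, j.2.1⟩, v ⟨j.1, j.2.1⟩), (e ⟨j.1, -1⟩, v ⟨j.1, -1⟩))
      else ((e ⟨j.1, j.2.1⟩, 1), (e ⟨j.1, -1⟩, 0))
    refine ⟨eqE ∘ (Fintype.equivFinOfCardEq hE).symm, ?_⟩
    ext ψ
    rw [hmem]
    have h1 : ψ ∈ solutions (eqE ∘ (Fintype.equivFinOfCardEq hE).symm) ↔ ∀ t,
        (eqE t).1.2 * ψ (eqE t).1.1 = (eqE t).2.2 * ψ (eqE t).2.1 :=
      ((Fintype.equivFinOfCardEq hE).symm.surjective.forall (p := fun t =>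
        (eqE t).1.2 * ψ (eqE t).1.1 = (eqE t).2.2 * ψ (eqE t).2.1)).symm
    rw [h1]
    constructor
    · rintro hψ ⟨i, s, hs⟩
      by_cases hc : c i = 1
      · simp only [eqE, hc, if_true]
        exact (hψ i s).1
      · simp only [eqE, hc, if_false, one_mul, zero_mul]
        obtain ⟨h2, h3⟩ := hψ i s
        rw [h3 hc] at h2
        exact (mul_eq_zero.1 h2).resolve_left (hv0 _)
    · intro hψ i s
      by_cases hc : c i = 1
      · refine ⟨?_, fun h => absurd hc h⟩
        by_cases hs : s = -1
        · rw [hs]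
        · have := hψ ⟨i, s, Or.inl hs⟩
          simpa only [eqE, hc, if_true] using this
      · have h2 (s) : ψ (e ⟨i, s⟩) = 0 := by
          have := hψ ⟨i, s, Or.inr hc⟩
          simpa only [eqE, hc, if_false, one_mul, zero_mul] using this
        simp [h2]
  -- There are `|α| - ‖ν‖` cycles with trivial cycle-product, and the values at their base points
  -- determine a potential.
  · have hcard : Nat.card α = Nat.card {i // c i = 1} + degree ν := by
      rw [hdeg, ← Nat.card_congr e, Nat.card_eq_fintype_card, Nat.card_eq_fintype_card,
        Fintype.card_sigma, Fintype.card_subtype, Finset.card_filter, ← Finset.sum_add_distrib]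
      refine Finset.sum_congr rfl fun i _ => ?_
      rw [ZMod.card]
      have := (k i).pos
      split_ifs <;> omega
    rw [hcard, pow_add, ← Nat.card_fun, ← Set.ncard_univ ({i // c i = 1} → WithZero Γ)]
    refine Nat.mul_le_mul_right _ (Set.ncard_le_ncard_of_injOn
      (fun (ψ : α → WithZero Γ) (i : {i // c i = 1}) => v ⟨i, -1⟩ * ψ (e ⟨i, -1⟩))
      (fun _ _ => Set.mem_univ _) ?_
      (Set.toFinite _))
    intro ψ hψ ψ' hψ' heq
    rw [hmem] at hψ hψ'
    funext a
    obtain ⟨⟨i, s⟩, rfl⟩ := e.surjective a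
    apply mul_left_cancel₀ (hv0 ⟨i, s⟩)
    refine (hψ i s).1.trans (Eq.trans ?_ (hψ' i s).1.symm)
    by_cases hc : c i = 1
    · exact congrFun heq ⟨i, hc⟩
    · exact ((hψ i s).2 hc).trans ((hψ' i s).2 hc).symm

/-- If the degree is additive on `x y`, then `x y` moves all the points that `x` or `y` moves. -/
theorem supp_subset_supp_mul [Finite Γ] [Finite α] {x y : Wreath Γ α} {lam mu ν : ModType Γ}
    (hx : HasModType x lam) (hy : HasModType y mu) (hxy : HasModType (x * y) ν)
    (hdeg : degree ν = degree lam + degree mu) : supp x ∪ supp y ⊆ supp (x * y) := by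
  classical
  have : Finite (WithZero Γ) := inferInstanceAs (Finite (Option Γ))
  obtain ⟨⟨E, hE⟩, -⟩ := hx.exists_equations
  obtain ⟨⟨F, hF⟩, -⟩ := hy.exists_equations
  have h1 := hxy.exists_equations.2
  have h2 : solutions (Fin.append E F) = potentials x ∩ potentials y := by
    rw [hE, hF]
    ext φ
    constructor
    · intro h
      refine ⟨fun t => ?_, fun t => ?_⟩
      · simpa using h (Fin.castAdd _ t)
      · simpa using h (Fin.natAdd _ t)
    · rintro ⟨h, h'⟩ t
      refine Fin.addCases (fun t => ?_) (fun t => ?_) t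
      · simpa using h t
      · simpa using h' t
  have h3 := card_pow_le_card_solutions_mul _ (Fin.append E F)
  rw [h2, ← hdeg] at h3
  -- The lower bound from elimination meets the upper bound for the potentials of `x * y`, so the
  -- inclusion is an equality.
  have h4 : potentials x ∩ potentials y = potentials (x * y) :=
    Set.eq_of_subset_of_ncard_le (inter_potentials_subset x y)
      (Nat.le_of_mul_le_mul_right (h1.trans h3) (Nat.pow_pos Nat.card_pos)) (Set.toFinite _)
  intro j
  contrapose
  intro hj
  have h5 := single_mem_potentials hj
  rw [← h4] at h5
  rw [Set.mem_union, not_or]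
  exact ⟨notMem_supp_of_single_mem h5.1, notMem_supp_of_single_mem h5.2⟩

/-! ### Counting factorizations by total support -/

instance finite_wreath [Finite Γ] [Finite α] : Finite (Wreath Γ α) :=
  Finite.of_equiv _ (SemidirectProduct.equivProd).symm

/-- The factorizations `z = x y` with `x` of type `lam`, `y` of type `mu` and total support `S`. -/
def pairSet (lam mu : ModType Γ) (z : Wreath Γ α) (S : Set α) : Set (Wreath Γ α × Wreath Γ α) :=
  {q | HasModType q.1 lam ∧ HasModType q.2 mu ∧ q.1 * q.2 = z ∧ supp q.1 ∪ supp q.2 = S}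

theorem hasModType_embedHom (e : α ↪ β) (x : Wreath Γ α) (lam : ModType Γ) :
    HasModType (embedHom Γ e x) lam ↔ HasModType x lam :=
  (intertwines_embedHom e x).hasModType_iff lam

theorem supp_embedHom (e : α ↪ β) (x : Wreath Γ α) : supp (embedHom Γ e x) = e '' supp x :=
  (intertwines_embedHom e x).image_supp.symm

theorem hasModType_conj (w x : Wreath Γ α) (lam : ModType Γ) :
    HasModType (w * x * w⁻¹) lam ↔ HasModType x lam :=
  (intertwines_conj w x).hasModType_iff lam

theorem supp_conj (w x : Wreath Γ α) : supp (w * x * w⁻¹) = w.right '' supp x :=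
  (intertwines_conj w x).image_supp.symm

theorem ncard_pairSet_embedHom (lam mu : ModType Γ) (e : α ↪ β) (z : Wreath Γ α) (S : Set α) :
    (pairSet lam mu (embedHom Γ e z) (e '' S)).ncard = (pairSet lam mu z S).ncard := by
  rw [← Set.ncard_image_of_injective (pairSet lam mu z S)
    ((embedHom_injective e).prodMap (embedHom_injective e))]
  congr 1
  ext ⟨x, y⟩
  constructor
  · rintro ⟨hx, hy, hz, hS⟩
    simp only at hx hy hz hS
    have hSr : supp x ∪ supp y ⊆ Set.range e := hS ▸ Set.image_subset_range e S
    obtain ⟨x, rfl⟩ := exists_embedHom_eq e (Set.subset_union_left.trans hSr)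
    obtain ⟨y, rfl⟩ := exists_embedHom_eq e (Set.subset_union_right.trans hSr)
    rw [hasModType_embedHom] at hx hy
    rw [supp_embedHom, supp_embedHom, ← Set.image_union] at hS
    rw [← map_mul] at hz
    exact ⟨(x, y), ⟨hx, hy, embedHom_injective e hz, Set.image_injective.2 e.injective hS⟩, rfl⟩
  · rintro ⟨⟨x, y⟩, ⟨hx, hy, hz, hS⟩, h⟩
    simp only at hx hy hz hS
    rw [Prod.map_apply, Prod.mk.injEq] at h
    obtain ⟨rfl, rfl⟩ := h
    refine ⟨(hasModType_embedHom e x lam).2 hx, (hasModType_embedHom e y mu).2 hy, ?_, ?_⟩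
    · simp only [← map_mul, hz]
    · simp only [supp_embedHom, ← Set.image_union, hS]

theorem ncard_pairSet_le_conj [Finite Γ] [Finite α] (lam mu : ModType Γ) (w z : Wreath Γ α) :
    (pairSet lam mu z Set.univ).ncard ≤ (pairSet lam mu (w * z * w⁻¹) Set.univ).ncard := by
  refine Set.ncard_le_ncard_of_injOn (fun q => (w * q.1 * w⁻¹, w * q.2 * w⁻¹)) ?_ ?_
    (Set.toFinite _)
  · rintro ⟨x, y⟩ ⟨hx, hy, hz, hS⟩
    simp only at hx hy hz hS
    refine ⟨(hasModType_conj w x lam).2 hx, (hasModType_conj w y mu).2 hy, ?_, ?_⟩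
    · simp only [← hz]; group
    · simp only [supp_conj, ← Set.image_union, hS, Set.image_univ, w.right.surjective.range_eq]
  · rintro ⟨x, y⟩ - ⟨x', y'⟩ - h
    simpa using h

theorem ncard_pairSet_eq_of_isConj [Finite Γ] [Finite α] (lam mu : ModType Γ) {z z' : Wreath Γ α}
    (h : IsConj z z') :
    (pairSet lam mu z Set.univ).ncard = (pairSet lam mu z' Set.univ).ncard := by
  apply le_antisymm
  · obtain ⟨w, rfl⟩ := isConj_iff.1 h
    exact ncard_pairSet_le_conj lam mu w z
  · obtain ⟨w, rfl⟩ := isConj_iff.1 h.symm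
    exact ncard_pairSet_le_conj lam mu w z'

open Classical in
/-- The number of factorizations, of total support a given set of `k` points, of an element of
modified type `ν` into elements of modified types `lam` and `mu`. -/
def pairNumber (lam mu ν : ModType Γ) (k : ℕ) : ℕ :=
  if h : ∃ z : WreathFin Γ k, HasModType z ν then (pairSet lam mu h.choose Set.univ).ncard else 0

theorem pairNumber_eq [Finite Γ] (lam mu : ModType Γ) {ν : ModType Γ} {k : ℕ} {z : WreathFin Γ k}
    (hz : HasModType z ν) : pairNumber lam mu ν k = (pairSet lam mu z Set.univ).ncard := by
  have h : ∃ z : WreathFin Γ k, HasModType z ν := ⟨z, hz⟩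
  rw [pairNumber, dif_pos h]
  exact ncard_pairSet_eq_of_isConj lam mu (h.choose_spec.isConj hz)

/-- All the factors live on the range of `e`, so the count is transported to `Fin k`, where only the
type of `z` matters. -/
theorem ncard_pairSet_range [Finite Γ] (lam mu : ModType Γ) {ν : ModType Γ} {z : Wreath Γ α}
    (hz : HasModType z ν) {k : ℕ} (e : Fin k ↪ α) (h : supp z ⊆ Set.range e) :
    (pairSet lam mu z (Set.range e)).ncard = pairNumber lam mu ν k := by
  obtain ⟨z, rfl⟩ := exists_embedHom_eq e h
  rw [hasModType_embedHom] at hz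
  rw [← Set.image_univ, ncard_pairSet_embedHom, pairNumber_eq lam mu hz]

theorem pairNumber_ne_zero_iff [Finite Γ] (lam mu ν : ModType Γ) (k : ℕ) :
    pairNumber lam mu ν k ≠ 0 ↔ ∃ x y : WreathFin Γ k, HasModType x lam ∧ HasModType y mu ∧
      HasModType (x * y) ν ∧ supp x ∪ supp y = Set.univ := by
  constructor
  · intro h
    rw [pairNumber] at h
    by_cases hz : ∃ z : WreathFin Γ k, HasModType z ν
    swap
    · exact absurd (dif_neg hz) h
    rw [dif_pos hz] at h
    obtain ⟨⟨x, y⟩, hx, hy, hxy, hS⟩ := Set.nonempty_of_ncard_ne_zero h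
    exact ⟨x, y, hx, hy, by rw [show x * y = hz.choose from hxy]; exact hz.choose_spec, hS⟩
  · rintro ⟨x, y, hx, hy, hxy, hS⟩
    rw [pairNumber_eq lam mu hxy]
    exact Set.ncard_ne_zero_of_mem (a := (x, y)) ⟨hx, hy, rfl, hS⟩ (Set.toFinite _)

/-- These bounds do not involve `n`; they make the counting sum finite uniformly in `n`. -/
theorem le_of_pairNumber_ne_zero [Finite Γ] {lam mu ν : ModType Γ} {k : ℕ}
    (h : pairNumber lam mu ν k ≠ 0) :
    supportSize ν ≤ k ∧ k ≤ supportSize lam + supportSize mu := by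
  obtain ⟨x, y, hx, hy, hxy, hS⟩ := (pairNumber_ne_zero_iff lam mu ν k).1 h
  constructor
  · rw [← hxy.ncard_supp_of_finite]
    exact (Set.ncard_le_card _).trans_eq (by simp)
  · have h1 := Set.ncard_union_le (supp x) (supp y)
    rw [hS, Set.ncard_univ, Nat.card_fin, hx.ncard_supp_of_finite, hy.ncard_supp_of_finite] at h1
    exact h1

/-- In the case of additive degree, all factorizations are supported on the support of the
product. -/
theorem eq_of_pairNumber_ne_zero [Finite Γ] {lam mu ν : ModType Γ} {k : ℕ}
    (hdeg : degree ν = degree lam + degree mu) (h : pairNumber lam mu ν k ≠ 0) :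
    k = supportSize ν := by
  refine le_antisymm ?_ (le_of_pairNumber_ne_zero h).1
  obtain ⟨x, y, hx, hy, hxy, hS⟩ := (pairNumber_ne_zero_iff lam mu ν k).1 h
  have h1 := supp_subset_supp_mul hx hy hxy hdeg
  rw [hS, Set.univ_subset_iff] at h1
  rw [← hxy.ncard_supp_of_finite, h1, Set.ncard_univ, Nat.card_fin]

/-- The factorizations `z = x y` with `x` of type `lam` and `y` of type `mu`. -/
def factorizations (lam mu : ModType Γ) (z : Wreath Γ α) : Set (Wreath Γ α × Wreath Γ α) :=
  {q | HasModType q.1 lam ∧ HasModType q.2 mu ∧ q.1 * q.2 = z}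

theorem ncard_factorizations_eq_sum [Finite Γ] [Fintype α] (lam mu : ModType Γ) (z : Wreath Γ α) :
    (factorizations lam mu z).ncard = ∑ S : Finset α, (pairSet lam mu z (S : Set α)).ncard := by
  classical
  have := Fintype.ofFinite (Wreath Γ α × Wreath Γ α)
  rw [Set.ncard_eq_toFinset_card',
    Finset.card_eq_sum_card_fiberwise (f := fun q => (supp q.1 ∪ supp q.2).toFinset)
      (t := Finset.univ) (fun _ _ => Finset.mem_coe.2 (Finset.mem_univ _))]
  refine Finset.sum_congr rfl fun S _ => ?_
  rw [Set.ncard_eq_toFinset_card']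
  congr 1
  ext q
  rw [Finset.mem_filter, Set.mem_toFinset, Set.mem_toFinset]
  simp only [factorizations, pairSet, Set.mem_ofPred_eq, and_assoc]
  refine and_congr_right fun _ => and_congr_right fun _ => and_congr_right fun _ => ?_
  rw [← Finset.coe_inj, Set.coe_toFinset]

/-- A superset of `T` with `|T| + d` elements amounts to `d` points of the complement. -/
theorem sum_superset_apply_card {α : Type*} [Fintype α] [DecidableEq α] (T : Finset α)
    (g : ℕ → ℕ) : (∑ S : Finset α, if T ⊆ S then g S.card else 0) =
      ∑ d ∈ Finset.range (Fintype.card α - T.card + 1),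
        (Fintype.card α - T.card).choose d * g (T.card + d) := by
  have h := Finset.sum_powerset_apply_card (fun d => g (T.card + d)) (x := Tᶜ)
  rw [Finset.card_compl] at h
  simp only [smul_eq_mul] at h
  rw [← h, ← Finset.sum_filter]
  refine Finset.sum_bij' (fun S _ => S \ T) (fun S _ => T ∪ S) ?_ ?_ ?_ ?_ ?_
  · intro S hS
    rw [Finset.mem_powerset, Finset.sdiff_eq_inter_compl]
    exact Finset.inter_subset_right
  · intro S _
    simp
  · intro S hS
    exact Finset.union_sdiff_of_subset (Finset.mem_filter.1 hS).2
  · intro S hS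
    exact Finset.union_sdiff_cancel_left
      (Finset.disjoint_left.2 fun a ha hb => Finset.mem_compl.1 (Finset.mem_powerset.1 hS hb) ha)
  · intro S hS
    have hTS := (Finset.mem_filter.1 hS).2
    rw [Finset.card_sdiff_of_subset hTS, Nat.add_sub_of_le (Finset.card_le_card hTS)]

theorem ncard_factorizations [Finite Γ] (lam mu : ModType Γ) {ν : ModType Γ} {n : ℕ}
    {z : WreathFin Γ n} (hz : HasModType z ν) :
    (factorizations lam mu z).ncard = ∑ d ∈ Finset.range (supportSize lam + supportSize mu + 1),
      (n - supportSize ν).choose d * pairNumber lam mu ν (supportSize ν + d) := by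
  classical
  have hT : (supp z).toFinset.card = supportSize ν := by
    rw [← Set.ncard_eq_toFinset_card', hz.ncard_supp_of_finite]
  have h1 : ∀ S : Finset (Fin n), (pairSet lam mu z (S : Set (Fin n))).ncard =
      if (supp z).toFinset ⊆ S then pairNumber lam mu ν S.card else 0 := by
    intro S
    split_ifs with hS
    · have hr : Set.range (S.orderEmbOfFin rfl).toEmbedding = (S : Set (Fin n)) :=
        Finset.range_orderEmbOfFin S rfl
      rw [← hr]
      refine ncard_pairSet_range lam mu hz _ ?_
      rw [hr]
      exact Set.toFinset_subset.1 hS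
    · rw [Set.ncard_eq_zero (Set.toFinite _), Set.eq_empty_iff_forall_notMem]
      rintro ⟨x, y⟩ ⟨-, -, hxy, hxyS⟩
      refine hS (Set.toFinset_subset.2 ?_)
      rw [← hxyS, ← hxy]
      exact supp_mul_subset x y
  rw [ncard_factorizations_eq_sum]
  simp only [h1]
  rw [sum_superset_apply_card (supp z).toFinset (pairNumber lam mu ν), hT, Fintype.card_fin]
  -- The sum naturally stops at `N`, which depends on `n`. Replacing this by `D` is harmless: beyond
  -- `N` the binomial vanishes, beyond `D` the pair number does.
  set N := n - supportSize ν
  set D := supportSize lam + supportSize mu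
  have h2 (d : ℕ) (hd : D < d) : N.choose d * pairNumber lam mu ν (supportSize ν + d) = 0 := by
    by_contra h
    have := (le_of_pairNumber_ne_zero (right_ne_zero_of_mul h)).2
    omega
  have h3 (d : ℕ) (hd : N < d) : N.choose d * pairNumber lam mu ν (supportSize ν + d) = 0 := by
    rw [Nat.choose_eq_zero_of_lt hd, zero_mul]
  rcases le_total N D with h | h
  · refine Finset.sum_subset (Finset.range_mono (by omega)) fun d _ hd => h3 d ?_
    rw [Finset.mem_range] at hd; omega
  · refine (Finset.sum_subset (Finset.range_mono (by omega)) fun d _ hd => h2 d ?_).symm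
    rw [Finset.mem_range] at hd; omega

/-! ### The structure polynomial -/

/-- The polynomial `(t - m)(t - m - 1) ⋯ (t - m - d + 1)`. -/
def shiftedDescPochhammer (m d : ℕ) : ℚ[X] := (descPochhammer ℚ d).comp (X - C (m : ℚ))

theorem natDegree_shiftedDescPochhammer (m d : ℕ) : (shiftedDescPochhammer m d).natDegree = d := by
  rw [shiftedDescPochhammer, natDegree_comp, descPochhammer_natDegree, natDegree_X_sub_C, mul_one]

theorem monic_shiftedDescPochhammer (m d : ℕ) : (shiftedDescPochhammer m d).Monic :=
  (monic_descPochhammer ℚ d).comp_X_sub_C _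

/-- `Ring.choose` is used because `n - m` may be negative; this gives integral values also below the
range where the structure constant is determined. -/
theorem eval_shiftedDescPochhammer (m d n : ℕ) :
    (shiftedDescPochhammer m d).eval (n : ℚ) =
      (d.factorial : ℚ) * ((Ring.choose ((n : ℤ) - m) d : ℤ) : ℚ) := by
  have h1 : (descPochhammer ℤ d).eval ((n : ℤ) - m) =
      d.factorial • Ring.choose ((n : ℤ) - m) d := by
    rw [eval_eq_smeval, Ring.descPochhammer_eq_factorial_smul_choose]
  have h2 := eval_intCast_map (Int.castRingHom ℚ) (descPochhammer ℤ d) ((n : ℤ) - m)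
  rw [descPochhammer_map] at h2
  simp only [Int.cast_id] at h2
  rw [h1] at h2
  rw [shiftedDescPochhammer, eval_comp]
  simpa using h2

/-- The polynomial whose values are the structure constants. -/
def structurePoly (lam mu ν : ModType Γ) : ℚ[X] :=
  ∑ d ∈ Finset.range (supportSize lam + supportSize mu + 1),
    C ((pairNumber lam mu ν (supportSize ν + d) : ℚ) / d.factorial) *
      shiftedDescPochhammer (supportSize ν) d

/-- The value of the structure polynomial at `n`. -/
def structureValue (lam mu ν : ModType Γ) (n : ℕ) : ℤ :=
  ∑ d ∈ Finset.range (supportSize lam + supportSize mu + 1),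
    (pairNumber lam mu ν (supportSize ν + d) : ℤ) * Ring.choose ((n : ℤ) - supportSize ν) d

theorem eval_structurePoly (lam mu ν : ModType Γ) (n : ℕ) :
    (structurePoly lam mu ν).eval (n : ℚ) = (structureValue lam mu ν n : ℚ) := by
  rw [structurePoly, structureValue, eval_finsetSum, Int.cast_sum]
  refine Finset.sum_congr rfl fun d _ => ?_
  have : (d.factorial : ℚ) ≠ 0 := Nat.cast_ne_zero.2 d.factorial_ne_zero
  rw [eval_mul, eval_C, eval_shiftedDescPochhammer]
  push_cast
  field_simp

theorem structureValue_eq [Finite Γ] (lam mu : ModType Γ) {ν : ModType Γ} {n : ℕ}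
    {z : WreathFin Γ n} (hz : HasModType z ν) :
    structureValue lam mu ν n = ((factorizations lam mu z).ncard : ℤ) := by
  have hn : supportSize ν ≤ n := by
    rw [← hz.ncard_supp_of_finite]
    exact (Set.ncard_le_card _).trans_eq (by simp)
  rw [ncard_factorizations lam mu hz, structureValue, Nat.cast_sum]
  refine Finset.sum_congr rfl fun d _ => ?_
  rw [← Nat.cast_sub hn, Ring.choose_natCast, Nat.cast_mul, mul_comm]

theorem structurePoly_eq_zero {lam mu ν : ModType Γ} (h : ∀ k, pairNumber lam mu ν k = 0) :
    structurePoly lam mu ν = 0 := by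
  simp [structurePoly, h]

theorem structurePoly_eq_C [Finite Γ] {lam mu ν : ModType Γ}
    (hdeg : degree ν = degree lam + degree mu) :
    structurePoly lam mu ν = C (pairNumber lam mu ν (supportSize ν) : ℚ) := by
  rw [structurePoly, Finset.sum_eq_single 0]
  · simp [shiftedDescPochhammer]
  · intro d _ hd
    have h : pairNumber lam mu ν (supportSize ν + d) = 0 := by
      by_contra h
      have := eq_of_pairNumber_ne_zero hdeg h
      omega
    simp [h]
  · simp

/-- The term of index `d` has degree exactly `d` when its coefficient is nonzero, so the last
nonzero term cannot be cancelled. -/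
theorem natDegree_structurePoly [Finite Γ] {lam mu ν : ModType Γ} {d : ℕ}
    (hd : pairNumber lam mu ν (supportSize ν + d) ≠ 0)
    (hmax : ∀ d', d < d' → pairNumber lam mu ν (supportSize ν + d') = 0) :
    structurePoly lam mu ν ≠ 0 ∧ (structurePoly lam mu ν).natDegree = d := by
  have hdD : d ∈ Finset.range (supportSize lam + supportSize mu + 1) := by
    have := (le_of_pairNumber_ne_zero hd).2
    rw [Finset.mem_range]; omega
  have hcoeff : (structurePoly lam mu ν).coeff d ≠ 0 := by
    rw [structurePoly, finsetSum_coeff, Finset.sum_eq_single d]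
    · have h1 := monic_shiftedDescPochhammer (supportSize ν) d
      rw [Monic, leadingCoeff, natDegree_shiftedDescPochhammer] at h1
      rw [coeff_C_mul, h1, mul_one]
      exact div_ne_zero (Nat.cast_ne_zero.2 hd) (Nat.cast_ne_zero.2 d.factorial_ne_zero)
    · intro d' _ hne
      rw [coeff_C_mul]
      rcases lt_or_gt_of_ne hne with h | h
      · rw [coeff_eq_zero_of_natDegree_lt (by rwa [natDegree_shiftedDescPochhammer]), mul_zero]
      · rw [hmax d' h, Nat.cast_zero, zero_div, zero_mul]
    · exact fun h => absurd hdD h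
  refine ⟨fun h => hcoeff (by rw [h, coeff_zero]), le_antisymm ?_ (le_natDegree_of_ne_zero hcoeff)⟩
  refine natDegree_sum_le_of_forall_le _ _ fun d' _ => ?_
  by_cases h : d < d'
  · simp [hmax d' h]
  · exact (natDegree_C_mul_le _ _).trans (by rw [natDegree_shiftedDescPochhammer]; omega)

/-! ### Class sums and structure constants -/

theorem toInf_mem_classInf_iff {n : ℕ} (x : WreathFin Γ n) (lam : ModType Γ) :
    toInf Γ n x ∈ classInf lam ↔ HasModType x lam := by
  change HasModType (extend Γ n x) lam ↔ _
  rw [extend_eq_embedHom, hasModType_embedHom]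

open Classical in
theorem classSum_eq_sum [Finite Γ] (n : ℕ) [Fintype (WreathFin Γ n)] (lam : ModType Γ) :
    classSum n lam = ∑ x : WreathFin Γ n with HasModType x lam, MonoidAlgebra.single x 1 := by
  rw [classSum, finsum_mem_eq_finite_toFinset_sum _ (Set.toFinite _)]
  refine Finset.sum_congr ?_ fun _ _ => rfl
  ext x
  simp [toInf_mem_classInf_iff]

open Classical in
theorem coeff_classSum [Finite Γ] (n : ℕ) (lam : ModType Γ) (z : WreathFin Γ n) :
    (classSum n lam).coeff z = if HasModType z lam then 1 else 0 := by
  have := Fintype.ofFinite (WreathFin Γ n)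
  rw [classSum_eq_sum, MonoidAlgebra.coeff_sum, Finsupp.finsetSum_apply]
  simp only [MonoidAlgebra.coeff_single, Finsupp.single_apply]
  rw [Finset.sum_ite_eq' _ z]
  simp

theorem coeff_classSum_mul [Finite Γ] (n : ℕ) (lam mu : ModType Γ) (z : WreathFin Γ n) :
    (classSum n lam * classSum n mu).coeff z = ((factorizations lam mu z).ncard : ℤ) := by
  classical
  have := Fintype.ofFinite (WreathFin Γ n)
  rw [classSum_eq_sum, classSum_eq_sum, Finset.sum_mul_sum, ← Finset.sum_product',
    MonoidAlgebra.coeff_sum, Finsupp.finsetSum_apply]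
  simp only [MonoidAlgebra.single_mul_single, MonoidAlgebra.coeff_single, Finsupp.single_apply,
    mul_one]
  rw [Finset.sum_boole, Set.ncard_eq_toFinset_card']
  congr 2
  ext q
  rw [Set.mem_toFinset]
  simp [factorizations, and_assoc]

/-- Each `z` occurs in exactly one class sum, so coefficients can be compared one by one. Types not
realized in `Γ_n` impose no condition on `a`. -/
theorem isStructureConstants_iff [Finite Γ] (n : ℕ) (lam mu : ModType Γ) (a : ModType Γ →₀ ℤ) :
    IsStructureConstants n lam mu a ↔ ∀ (z : WreathFin Γ n) (ν : ModType Γ), HasModType z ν →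
      ((factorizations lam mu z).ncard : ℤ) = a ν := by
  classical
  have key (z : WreathFin Γ n) (ν : ModType Γ) (hz : HasModType z ν) :
      (a.sum fun ν m => m • classSum n ν).coeff z = a ν := by
    rw [MonoidAlgebra.coeff_finsuppSum, Finsupp.sum, Finsupp.finsetSum_apply,
      Finset.sum_eq_single ν]
    · rw [MonoidAlgebra.coeff_smul_apply, coeff_classSum, if_pos hz, smul_eq_mul, mul_one]
    · intro ν' _ hne
      rw [MonoidAlgebra.coeff_smul_apply, coeff_classSum, if_neg, smul_zero]
      exact fun h => hne (h.unique hz)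
    · intro h
      rw [Finsupp.notMem_support_iff.1 h, zero_smul]
      rfl
  constructor
  · intro h z ν hz
    rw [← coeff_classSum_mul, h, key z ν hz]
  · intro h
    apply MonoidAlgebra.ext
    ext z
    obtain ⟨ν, hz⟩ := exists_hasModType z
    rw [key z ν hz, coeff_classSum_mul, h z ν hz]

/-! ### Passage to `Γ_∞` and classes of pairs -/

theorem HasModType.ncard_supp [Finite Γ] {x : Wreath Γ α} {ν : ModType Γ} (h : HasModType x ν)
    (hx : (supp x).Finite) : (supp x).ncard = supportSize ν := by
  obtain ⟨k, e, he⟩ := hx.fin_embedding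
  obtain ⟨x, rfl⟩ := exists_embedHom_eq e he.ge
  rw [hasModType_embedHom] at h
  rw [(intertwines_embedHom e x).card_supp, h.ncard_supp_of_finite]

theorem exists_common_embedding {x y : Wreath Γ α} (hx : (supp x).Finite) (hy : (supp y).Finite) :
    ∃ (k : ℕ) (e : Fin k ↪ α) (x' y' : WreathFin Γ k), Set.range e = supp x ∪ supp y ∧
      embedHom Γ e x' = x ∧ embedHom Γ e y' = y := by
  obtain ⟨k, e, he⟩ := (hx.union hy).fin_embedding
  obtain ⟨x', hx'⟩ := exists_embedHom_eq e (Set.subset_union_left.trans he.ge)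
  obtain ⟨y', hy'⟩ := exists_embedHom_eq e (Set.subset_union_right.trans he.ge)
  exact ⟨k, e, x', y', he, hx', hy'⟩

theorem suppSet_singleton (x : wreathInf Γ) : suppSet {x} = supp (x : Wreath Γ ℕ) := by
  ext j
  simp [suppSet]

theorem suppSet_pair (x y : wreathInf Γ) :
    suppSet {x, y} = supp (x : Wreath Γ ℕ) ∪ supp (y : Wreath Γ ℕ) := by
  ext j
  simp [suppSet]

theorem suppCard_mk_pair (x y : wreathInf Γ) :
    TupleClass.suppCard (Quotient.mk (tupleSetoid Γ 2) ![x, y]) =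
      (supp (x : Wreath Γ ℕ) ∪ supp (y : Wreath Γ ℕ)).ncard := by
  rw [← suppSet_pair]
  change (suppSet (Set.range ![x, y])).ncard = _
  rw [Matrix.range_cons, Matrix.range_cons, Matrix.range_empty, Set.union_empty]
  rfl

/-- Enumerating the total support of a pair in `Γ_∞` turns it into a pair over `Fin k` with full
total support, and conversely. -/
theorem exists_mem_pairClasses_iff [Finite Γ] (lam mu ν : ModType Γ) (k : ℕ) :
    (∃ C ∈ pairClasses lam mu ν, C.suppCard = k) ↔ pairNumber lam mu ν k ≠ 0 := by
  rw [pairNumber_ne_zero_iff]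
  constructor
  · rintro ⟨_, ⟨⟨x, hxf⟩, hx, ⟨y, hyf⟩, hy, hxy, rfl⟩, hcard⟩
    rw [suppCard_mk_pair] at hcard
    obtain ⟨l, e, x, y, he, rfl, rfl⟩ := exists_common_embedding hxf hyf
    have hxy' : HasModType (embedHom Γ e x * embedHom Γ e y) ν := hxy
    rw [← map_mul, hasModType_embedHom] at hxy'
    obtain rfl : l = k := by
      rw [← hcard]
      simp only
      rw [← he, ← Set.image_univ, Set.ncard_image_of_injective _ e.injective, Set.ncard_univ,
        Nat.card_fin]
    refine ⟨x, y, (hasModType_embedHom e x lam).1 hx, (hasModType_embedHom e y mu).1 hy, hxy', ?_⟩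
    rw [supp_embedHom, supp_embedHom, ← Set.image_union, ← Set.image_univ] at he
    exact (Set.image_injective.2 e.injective he).symm
  · rintro ⟨x, y, hx, hy, hxy, hS⟩
    refine ⟨_, ⟨toInf Γ k x, (toInf_mem_classInf_iff x lam).2 hx, toInf Γ k y,
      (toInf_mem_classInf_iff y mu).2 hy, ?_, rfl⟩, ?_⟩
    · rw [← map_mul]
      exact (toInf_mem_classInf_iff _ ν).2 hxy
    · rw [suppCard_mk_pair]
      change (supp (extend Γ k x) ∪ supp (extend Γ k y)).ncard = k
      rw [extend_eq_embedHom, extend_eq_embedHom, supp_embedHom, supp_embedHom, ← Set.image_union,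
        hS, Set.ncard_image_of_injective _ Fin.valEmbedding.injective, Set.ncard_univ, Nat.card_fin]

theorem suppSet_pair_eq_suppSet_mul [Finite Γ] {lam mu ν : ModType Γ}
    (hdeg : degree ν = degree lam + degree mu) {x y : wreathInf Γ} (hx : x ∈ classInf lam)
    (hy : y ∈ classInf mu) (hxy : x * y ∈ classInf ν) : suppSet {x, y} = suppSet {x * y} := by
  rw [suppSet_pair, suppSet_singleton]
  obtain ⟨x, hxf⟩ := x
  obtain ⟨y, hyf⟩ := y
  refine Set.Subset.antisymm ?_ (supp_mul_subset x y)
  obtain ⟨k, e, x, y, he, rfl, rfl⟩ := exists_common_embedding hxf hyf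
  have hxy' : HasModType (embedHom Γ e x * embedHom Γ e y) ν := hxy
  rw [← map_mul, hasModType_embedHom] at hxy'
  have h := supp_subset_supp_mul ((hasModType_embedHom e x lam).1 hx)
    ((hasModType_embedHom e y mu).1 hy) hxy' hdeg
  change supp (embedHom Γ e x) ∪ supp (embedHom Γ e y) ⊆ supp (embedHom Γ e x * embedHom Γ e y)
  rw [← map_mul, supp_embedHom, supp_embedHom, supp_embedHom, ← Set.image_union]
  exact Set.image_mono h

/-- Every `ν` that occurs is realized in one fixed finite group, on `supportSize lam + supportSize
mu` points, and each element has only one type. -/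
theorem finite_setOf_structurePoly_ne_zero [Finite Γ] (lam mu : ModType Γ) :
    {ν | structurePoly lam mu ν ≠ 0}.Finite := by
  choose t ht using fun x : WreathFin Γ (supportSize lam + supportSize mu) => exists_hasModType x
  refine (Set.finite_range t).subset fun ν hν => ?_
  obtain ⟨k, hk⟩ : ∃ k, pairNumber lam mu ν k ≠ 0 := by
    by_contra! h
    exact hν (structurePoly_eq_zero h)
  obtain ⟨h1, h2⟩ := le_of_pairNumber_ne_zero hk
  obtain ⟨x, hx⟩ := exists_hasModType_fin ν (h1.trans h2)
  exact ⟨x, (ht x).unique hx⟩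

end WreathFH
end

/-! ### The main theorem -/

theorem mainTheorem1 {Γ : Type*} [Group Γ] [Finite Γ] (lam mu : WreathFH.ModType Γ) :
    ∃ f : WreathFH.ModType Γ →₀ ℚ[X],
      -- for every `n`, the values `f ν (n)` are integers and are structure constants
      (∀ n : ℕ, ∃ a : WreathFH.ModType Γ →₀ ℤ,
        WreathFH.IsStructureConstants n lam mu a ∧ ∀ ν, (f ν).eval (n : ℚ) = (a ν : ℚ)) ∧
      ∀ ν : WreathFH.ModType Γ,
        -- wherever the structure constant is determined, it is the value of `f ν`
        (∀ n : ℕ, WreathFH.degree ν + (ν 1).card ≤ n → ∀ a : WreathFH.ModType Γ →₀ ℤ,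
          WreathFH.IsStructureConstants n lam mu a → (f ν).eval (n : ℚ) = (a ν : ℚ)) ∧
        -- and `f ν` is the only polynomial with this property
        (∀ g : ℚ[X],
          (∀ n : ℕ, WreathFH.degree ν + (ν 1).card ≤ n → ∀ a : WreathFH.ModType Γ →₀ ℤ,
            WreathFH.IsStructureConstants n lam mu a → g.eval (n : ℚ) = (a ν : ℚ)) →
          g = f ν) ∧
        -- the degree
        (WreathFH.pairClasses lam mu ν = ∅ → f ν = 0) ∧
        ((WreathFH.pairClasses lam mu ν).Nonempty → f ν ≠ 0 ∧
          ∀ z ∈ WreathFH.classInf ν,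
            IsGreatest {d : ℤ | ∃ C ∈ WreathFH.pairClasses lam mu ν,
              d = (C.suppCard : ℤ) - ((WreathFH.suppSet {z}).ncard : ℤ)}
              ((f ν).natDegree : ℤ)) ∧
        -- the case of equal degrees
        (WreathFH.degree ν = WreathFH.degree lam + WreathFH.degree mu →
          (∃ k : ℕ, f ν = Polynomial.C (k : ℚ)) ∧
          ∀ x ∈ WreathFH.classInf lam, ∀ y ∈ WreathFH.classInf mu,
            x * y ∈ WreathFH.classInf ν →
              WreathFH.suppSet {x, y} = WreathFH.suppSet {x * y}) := by
  classical
  have hfin := WreathFH.finite_setOf_structurePoly_ne_zero lam mu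
  let f : WreathFH.ModType Γ →₀ ℚ[X] :=
    Finsupp.onFinset hfin.toFinset (WreathFH.structurePoly lam mu) fun ν hν => by simpa using hν
  have hf (ν) : f ν = WreathFH.structurePoly lam mu ν := rfl
  have hex (n : ℕ) : ∃ a : WreathFH.ModType Γ →₀ ℤ,
      WreathFH.IsStructureConstants n lam mu a ∧ ∀ ν, (f ν).eval (n : ℚ) = (a ν : ℚ) := by
    -- Where the structure constants are undetermined, they are chosen to be the values of the
    -- polynomial.
    refine ⟨Finsupp.onFinset hfin.toFinset (fun ν => WreathFH.structureValue lam mu ν n) ?_,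
      (WreathFH.isStructureConstants_iff n lam mu _).2 ?_, fun ν => ?_⟩
    · intro ν hν
      have h1 := WreathFH.eval_structurePoly lam mu ν n
      rw [Set.Finite.mem_toFinset]
      intro h
      rw [h, eval_zero] at h1
      exact hν (Int.cast_eq_zero.1 h1.symm)
    · intro z ν hz
      exact (WreathFH.structureValue_eq lam mu hz).symm
    · rw [hf]
      exact WreathFH.eval_structurePoly lam mu ν n
  refine ⟨f, hex, fun ν => ?_⟩
  have hdet (n : ℕ) (hn : WreathFH.degree ν + (ν 1).card ≤ n) (a : WreathFH.ModType Γ →₀ ℤ)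
      (ha : WreathFH.IsStructureConstants n lam mu a) : (f ν).eval (n : ℚ) = (a ν : ℚ) := by
    obtain ⟨z, hz⟩ := WreathFH.exists_hasModType_fin ν hn
    rw [hf, WreathFH.eval_structurePoly, WreathFH.structureValue_eq lam mu hz,
      (WreathFH.isStructureConstants_iff n lam mu a).1 ha z ν hz]
  refine ⟨hdet, fun g hg => ?_, fun hempty => ?_, fun hne => ?_, fun hdeg => ⟨?_, ?_⟩⟩
  -- Two such polynomials agree at every `n ≥ ‖ν‖ + ℓ(ν(1))`.
  · apply Polynomial.eq_of_infinite_eval_eq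
    refine ((Set.Ici_infinite (WreathFH.degree ν + (ν 1).card)).image
      (Nat.cast_injective (R := ℚ)).injOn).mono ?_
    rintro _ ⟨n, hn, rfl⟩
    obtain ⟨a, ha, hfa⟩ := hex n
    exact (hg n hn a ha).trans (hfa ν).symm
  · refine WreathFH.structurePoly_eq_zero fun k => ?_
    by_contra h
    obtain ⟨C, hC, -⟩ := (WreathFH.exists_mem_pairClasses_iff lam mu ν k).2 h
    rw [hempty] at hC
    exact hC
  · have hpos : ∃ d, WreathFH.pairNumber lam mu ν (WreathFH.supportSize ν + d) ≠ 0 := by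
      obtain ⟨C, hC⟩ := hne
      have h := (WreathFH.exists_mem_pairClasses_iff lam mu ν _).1 ⟨C, hC, rfl⟩
      obtain ⟨d, hd⟩ := Nat.exists_eq_add_of_le (WreathFH.le_of_pairNumber_ne_zero h).1
      exact ⟨d, hd ▸ h⟩
    have hbd (d : ℕ) (h : WreathFH.pairNumber lam mu ν (WreathFH.supportSize ν + d) ≠ 0) :
        d ≤ WreathFH.supportSize lam + WreathFH.supportSize mu := by
      have := (WreathFH.le_of_pairNumber_ne_zero h).2
      omega
    obtain ⟨d₀, hd₀⟩ := hpos
    -- The greatest excess `d` of the total support over the support of the product exists because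
    -- `hbd` bounds it.
    have hspec := Nat.findGreatest_spec
      (P := fun d => WreathFH.pairNumber lam mu ν (WreathFH.supportSize ν + d) ≠ 0) (hbd d₀ hd₀) hd₀
    set d := Nat.findGreatest
      (fun d => WreathFH.pairNumber lam mu ν (WreathFH.supportSize ν + d) ≠ 0)
      (WreathFH.supportSize lam + WreathFH.supportSize mu)
    have hle (d' : ℕ) (h : WreathFH.pairNumber lam mu ν (WreathFH.supportSize ν + d') ≠ 0) :
        d' ≤ d := Nat.le_findGreatest (hbd d' h) h
    obtain ⟨h1, h2⟩ := WreathFH.natDegree_structurePoly hspec fun d' h => by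
      by_contra h'
      exact absurd (hle d' h') (by omega)
    refine ⟨h1, fun z hz => ?_⟩
    rw [hf, h2, WreathFH.suppSet_singleton, WreathFH.HasModType.ncard_supp hz z.2]
    constructor
    · obtain ⟨C, hC, hCd⟩ := (WreathFH.exists_mem_pairClasses_iff lam mu ν _).2 hspec
      exact ⟨C, hC, by rw [hCd]; push_cast; ring⟩
    · rintro _ ⟨C, hC, rfl⟩
      have h := (WreathFH.exists_mem_pairClasses_iff lam mu ν _).1 ⟨C, hC, rfl⟩
      obtain ⟨d', hd'⟩ := Nat.exists_eq_add_of_le (WreathFH.le_of_pairNumber_ne_zero h).1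
      rw [hd'] at h ⊢
      have := hle d' h
      push_cast
      omega
  · exact ⟨_, WreathFH.structurePoly_eq_C hdeg⟩
  · exact fun x hx y hy hxy => WreathFH.suppSet_pair_eq_suppSet_mul hdeg hx hy hxy
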